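/- \textbf{Broadcast against a single adversarial edge.} Consider the following \emph{adversarial CONGEST} model. The network is a finite simple graph $G=(V,E)$ with $n\ge 2$ nodes; the nodes have distinct identifiers bounded by a polynomial in $n$. All nodes run the same deterministic algorithm in synchronous rounds. Initially a node knows only its own identifier, the identifiers of its neighbours (that is, of its incident edges) and a common polynomial estimate $N$ of the number of nodes, $n\le N\le n^{O(1)}$; it knows neither the topology nor the diameter. In each round every node may send a message of $O(\log n)$ bits, possibly a different one, to each of its neighbours. A designated source $s\in V$ holds a message $m_0$ of $O(\log n)$ bits and starts the algorithm; every other node is asleep until it receives its first message, and there is no global clock. A set $F\subseteq E$ of at most one edge, fixed but unknown to the nodes, is controlled by a computationally unbounded, adaptive adversary, who knows the graph, the identifiers, the algorithm and $m_0$: in each round, depending on all messages sent in the network so far, it replaces what is delivered in each direction of the edge in $F$ by an arbitrary message of $O(\log n)$ bits, or by nothing. A node halts by producing an irrevocable output; a halted node sends nothing. Then there is a deterministic algorithm in this model such that for every $3$-edge-connected graph $G$ of diameter $D$, all identifiers, every estimate $N$, every source $s$, every message $m_0$, every $F\subseteq E$ with $|F|\le 1$ and every adaptive adversary controlling $F$,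 within $\widetilde{O}(D^2)=O(D^2\,\mathrm{poly}\log n)$ rounds every node $v$ has halted with an output $(m_0,d_v)$, where $d_v$ is a linear estimate of the diameter: $D\le d_v\le a\,D$ for an absolute constant $a$. The constants in the bandwidth $O(\log n)$ and in the round bound depend only on the constants in the polynomial bounds on the identifiers and on $N$ and in the $O(\log n)$ bound on the length of $m_0$. -/

import Mathlib

namespace AdvCongest

/-- Bit strings of length at most `b`: what one direction of an edge can carry in one round. -/
abbrev Msg (b : ℕ) : Type := {w : List Bool // w.length ≤ b}

/-- The initial knowledge of a node: its own identifier, the identifiers of its neighbours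
(equivalently, of its incident edges, an edge being named by the identifiers of its endpoints),
and, for the source only, the message to be broadcast. -/
structure LocalInput where
  ownId : ℕ
  nbrIds : Finset ℕ
  source : Option (List Bool)

/-- A deterministic distributed algorithm with bandwidth `b`, the same for all the nodes.
In each round a node sends to each neighbour (addressed by its identifier) a message or nothing,
as a function of its state, and then updates its state from the set of pairs
(identifier of the sending neighbour, received message). There is no access to a global clock.
`output` is the final decision (message, diameter estimate); a node that has decided has halted. -/
structure Protocol (b : ℕ) where
  State : Type
  init : LocalInput → State
  send : State → ℕ → Option (Msg b)
  recv : State → Set (ℕ × Msg b) → State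
  output : State → Option (List Bool × ℕ)

/-- The messages of one round: `x u v` is what is put on the edge from `u` towards `v`. -/
abbrev Traffic (V : Type*) (b : ℕ) := V → V → Option (Msg b)

/-- A computationally unbounded adaptive adversary. Given everything that the nodes have sent, in
the current round (head of the list) and in all the earlier rounds, it chooses what each direction
of each adversarial edge delivers in the current round. -/
abbrev Adversary (V : Type*) (b : ℕ) := List (Traffic V b) → Traffic V b

section Execution

variable {V : Type*} [Fintype V] {b : ℕ}

open Classical in
/-- The initial knowledge of `v` when `s` is the source with message `m₀`. -/
noncomputable def localInput (G : SimpleGraph V) (ident : V → ℕ) (s : V) (m₀ : List Bool) (v : V) :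
    LocalInput where
  ownId := ident v
  nbrIds := (Finset.univ.filter fun u => G.Adj v u).image ident
  source := if v = s then some m₀ else none

/-- The states of all the nodes; `none` is a node that is still asleep. -/
abbrev Config (V : Type*) (P : Protocol b) := V → Option P.State

/-- What the nodes send: nodes that are asleep or have halted send nothing. -/
def sent (P : Protocol b) (ident : V → ℕ) (c : Config V P) : Traffic V b := fun u v =>
  match c u with
  | none => none
  | some q =>
    match P.output q with
    | none => P.send q (ident v)
    | some _ => none

open Classical in
/-- What the edges deliver: the edges of `F` whatever the adversary wants, all others faithfully. -/
noncomputable def delivered (F : Set (Sym2 V)) (x bad : Traffic V b) : Traffic V b := fun u v =>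
  if s(u, v) ∈ F then bad u v else x u v

/-- The messages received by `v`, each with the identifier of the neighbour it comes from. -/
def inbox (G : SimpleGraph V) (ident : V → ℕ) (y : Traffic V b) (v : V) : Set (ℕ × Msg b) :=
  {p | ∃ u, G.Adj u v ∧ p.1 = ident u ∧ y u v = some p.2}

open Classical in
/-- The state change of a single node with initial knowledge `inp`. A sleeping node is woken up
by the first message that it receives; a node that has halted does not change any more. -/
noncomputable def nextState (P : Protocol b) (inp : LocalInput) (I : Set (ℕ × Msg b)) :
    Option P.State → Option P.State
  | none => if I = ∅ then none else some (P.recv (P.init inp) I)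
  | some q =>
    match P.output q with
    | none => some (P.recv q I)
    | some _ => some q

open Classical in
/-- The configuration after `r` rounds, with the list of the messages sent so far (latest round
first). At the start only the source is awake. -/
noncomputable def run (G : SimpleGraph V) (ident : V → ℕ) (P : Protocol b) (s : V)
    (m₀ : List Bool) (F : Set (Sym2 V)) (A : Adversary V b) :
    ℕ → Config V P × List (Traffic V b)
  | 0 => (fun v => if v = s then some (P.init (localInput G ident s m₀ v)) else none, [])
  | r + 1 =>
    let c := (run G ident P s m₀ F A r).1
    let hist := sent P ident c :: (run G ident P s m₀ F A r).2
    let y := delivered F (sent P ident c) (A hist)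
    (fun v => nextState P (localInput G ident s m₀ v) (inbox G ident y v) (c v), hist)

/-- After `r` rounds node `v` has halted with output message `m` and diameter estimate `d`. -/
def HaltedWith (G : SimpleGraph V) (ident : V → ℕ) (P : Protocol b) (s : V)
    (m₀ : List Bool) (F : Set (Sym2 V)) (A : Adversary V b) (r : ℕ) (v : V)
    (m : List Bool) (d : ℕ) : Prop :=
  ∃ q, (run G ident P s m₀ F A r).1 v = some q ∧ P.output q = some (m, d)

end Execution

end AdvCongest

/-! Deleting two edges from a 3-edge-connected graph of diameter `D` leaves all distances at most
`13 * D` (`dist_deleteEdges_pair_le`). This makes it possible to flood one bit reliably. Every node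
keeps a set of edges, meant to contain all those that no short walk from a source avoids, and
repeatedly intersects it with the sets `Z ∪ {uv}` built from what its neighbours `u` send. The
receiver adds `uv` itself, so whatever comes over the adversarial edge `e` yields a set containing
`e`; hence a set without `e` certifies a walk avoiding `e` (`mem_reach_of_notMem_cut`). A node
accepts when its set is empty. Acceptance thus proves that a source exists nearby, and it does occur
if a source stays near whichever second edge is deleted along with `e` (`accept_of_forall_reach`).
After `i` iterations a set has at most `i` elements, so a channel of `l` iterations costs about `l ^
2` rounds.

Phase `j` tests the guess `2 ^ j`. The source floods to distance `2 ^ j`, and nodes that do not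
accept raise an alarm in a longer channel. For `2 ^ j ≥ 13 * D` everybody accepts, and an alarm
without a source cannot be forged (`passes_of_diam_le`). Conversely, if the source accepts no alarm,
then for some edge `f` all vertices near it in `G - e - f` were reached within `2 ^ j` steps
avoiding `e`, which forces `D ≤ 8 * 2 ^ j` (`diam_le_of_passes`). The remaining channels are then
long enough to deliver every true fact about the message, while false facts have no source. In a
phase with an accepted alarm no fact is sent and nobody halts. So all nodes halt after the same
phase, with `2 ^ j = O(D)`; the phases cost a geometric sum `O(D ^ 2)` times the number `O(log n)`
of channels per phase. -/

namespace AdvCongest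

/-! ### Distances after the deletion of one or two edges. -/

section Reach

variable {V : Type*}

/-- The vertices that are joined to `S` by a walk of length at most `n` in `H`. -/
def reach (H : SimpleGraph V) (S : Set V) : ℕ → Set V
  | 0 => S
  | n + 1 => reach H S n ∪ {v | ∃ u ∈ reach H S n, H.Adj u v}

lemma reach_mono (H : SimpleGraph V) (S : Set V) : Monotone (reach H S) :=
  monotone_nat_of_le_succ fun _ => Set.subset_union_left

lemma exists_mem_of_mem_reach {H : SimpleGraph V} {S : Set V} {n : ℕ} {v : V}
    (h : v ∈ reach H S n) : ∃ u ∈ S, ∃ w : H.Walk u v, w.length ≤ n := by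
  induction n generalizing v with
  | zero => exact ⟨v, h, .nil, le_rfl⟩
  | succ n ih =>
    rcases h with h | ⟨x, hx, hxv⟩
    · obtain ⟨u, hu, w, hw⟩ := ih h
      exact ⟨u, hu, w, by omega⟩
    · obtain ⟨u, hu, w, hw⟩ := ih hx
      exact ⟨u, hu, w.concat hxv, by simpa using hw⟩

lemma mem_reach_of_walk {H : SimpleGraph V} {S : Set V} {u v : V} (w : H.Walk u v) {n : ℕ}
    (hu : u ∈ reach H S n) : v ∈ reach H S (n + w.length) := by
  induction w generalizing n with
  | nil => exact hu
  | cons h w ih =>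
    have := ih (n := n + 1) (Or.inr ⟨_, hu, h⟩)
    rwa [SimpleGraph.Walk.length_cons, Nat.add_comm w.length, ← Nat.add_assoc]

lemma mem_reach_of_dist_le {H : SimpleGraph V} (hH : H.Connected) {S : Set V} {u v : V} {n : ℕ}
    (hu : u ∈ S) (h : H.dist u v ≤ n) : v ∈ reach H S n := by
  obtain ⟨w, hw⟩ := hH.exists_walk_length_eq_dist u v
  have := mem_reach_of_walk (S := S) w (n := 0) hu
  exact reach_mono H S (by omega) this

lemma dist_le_of_mem_reach {H : SimpleGraph V} {u v : V} {n : ℕ} (h : v ∈ reach H {u} n) :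
    H.dist u v ≤ n := by
  obtain ⟨x, rfl, w, hw⟩ := exists_mem_of_mem_reach h
  exact (SimpleGraph.dist_le w).trans hw

lemma exists_dist_eq {H : SimpleGraph V} (hH : H.Connected) {u v : V} {n : ℕ}
    (h : n ≤ H.dist u v) : ∃ x, H.dist u x = n := by
  obtain ⟨w, hw⟩ := hH.exists_walk_length_eq_dist u v
  refine ⟨w.getVert n, ?_⟩
  have := SimpleGraph.length_eq_dist_of_subwalk hw (w.isSubwalk_take n)
  rw [← this, SimpleGraph.Walk.take_length]
  omega

/-- One crossing of `e` is enough: crossing back leads to the endpoint `p`, which was already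
reached without `e`. -/
lemma reach_of_avoid {G H : SimpleGraph V} {e : Sym2 V}
    (hGH : ∀ u v, G.Adj u v → s(u, v) ≠ e → H.Adj u v) {s : V} {n : ℕ} {v : V}
    (h : v ∈ reach G {s} n) : v ∈ reach H {s} n ∨
      ∃ p q, e = s(p, q) ∧ p ∈ reach H {s} n ∧ v ∈ reach H {q} n := by
  induction n generalizing v with
  | zero => exact Or.inl h
  | succ n ih =>
    have up : ∀ S, reach H S n ⊆ reach H S (n + 1) := fun S => reach_mono H S n.le_succ
    rcases h with h | ⟨x, hx, hxv⟩
    · rcases ih h with h | ⟨p, q, he, hp, hq⟩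
      · exact Or.inl (up _ h)
      · exact Or.inr ⟨p, q, he, up _ hp, up _ hq⟩
    · by_cases hxe : s(x, v) = e
      · rcases ih hx with h | ⟨p, q, he, hp, hq⟩
        · exact Or.inr ⟨x, v, hxe.symm, up _ h, reach_mono H _ (Nat.zero_le _) rfl⟩
        · rw [← hxe, Sym2.eq_iff] at he
          rcases he with ⟨rfl, rfl⟩ | ⟨rfl, rfl⟩
          · exact Or.inr ⟨x, v, hxe.symm, up _ hp, reach_mono H _ (Nat.zero_le _) rfl⟩
          · exact Or.inl (up _ hp)
      · have hA := hGH _ _ hxv hxe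
        rcases ih hx with h | ⟨p, q, he, hp, hq⟩
        · exact Or.inl (Or.inr ⟨x, h, hA⟩)
        · exact Or.inr ⟨p, q, he, up _ hp, Or.inr ⟨x, hq, hA⟩⟩

/-- If `H` arises from `G` by deleting one edge, and the vertices of the ball of radius `l` about
`s` in `H` have distance at most `R` from `s` in `G`, then either `l ≤ 3 * R + 1` or no vertex has
distance `l` from `s` in `H`. -/
lemma le_of_dist_eq_of_avoid {G H : SimpleGraph V} {e : Sym2 V} (hH : H.Connected)
    (hGH : ∀ u v, G.Adj u v → s(u, v) ≠ e → H.Adj u v) {s y : V} {l R : ℕ}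
    (hball : ∀ x, H.dist s x ≤ l → x ∈ reach G {s} R) (hy : H.dist s y = l) : l ≤ 3 * R + 1 := by
  by_contra! hl
  -- Both `w` and `y` lie beyond radius `R` in `H`, so their short walks in `G` cross `e`. If they
  -- cross in the same direction, `w` and `y` are both within `R` of `q`, and `s` is within `(R + 1)
  -- + 2 * R` of `y`. Otherwise `q` is within `R` of `s`, and `y` within `2 * R`.
  obtain ⟨w, hw⟩ := exists_dist_eq hH (u := s) (v := y) (n := R + 1) (by omega)
  rcases reach_of_avoid hGH (hball y hy.le) with h | ⟨p, q, he, hp, hq⟩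
  · have := dist_le_of_mem_reach h
    omega
  rcases reach_of_avoid hGH (hball w (by omega)) with h | ⟨p', q', he', hp', hq'⟩
  · have := dist_le_of_mem_reach h
    omega
  have h1 := dist_le_of_mem_reach hp
  have h2 := dist_le_of_mem_reach hq
  have h3 := dist_le_of_mem_reach hp'
  have h4 := dist_le_of_mem_reach hq'
  rw [he, Sym2.eq_iff] at he'
  rcases he' with ⟨rfl, rfl⟩ | ⟨rfl, rfl⟩
  · have t1 := hH.dist_triangle (u := s) (v := w) (w := y)
    have t2 := hH.dist_triangle (u := w) (v := q) (w := y)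
    have t3 := H.dist_comm (u := w) (v := q)
    omega
  · have t1 := hH.dist_triangle (u := s) (v := q) (w := y)
    omega

lemma connected_deleteEdges_pair [Nonempty V] {G : SimpleGraph V} (hG : G.IsEdgeConnected 3)
    (e f : Sym2 V) : (G.deleteEdges {e, f}).Connected := by
  have : (G.deleteEdges {e, f}).Preconnected := fun u v => hG u v <|
    (Set.encard_insert_le {f} e).trans_lt (by rw [Set.encard_singleton]; norm_num)
  exact ⟨this⟩

lemma dist_deleteEdges_pair_le [Finite V] [Nontrivial V] {G : SimpleGraph V}
    (hG : G.IsEdgeConnected 3) (e f : Sym2 V) (u v : V) :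
    (G.deleteEdges {e, f}).dist u v ≤ 13 * G.diam := by
  have hc : G.Connected := hG.connected (by norm_num)
  have hD : G.diam ≠ 0 := SimpleGraph.connected_iff_diam_ne_zero.1 hc
  have h0 : ∀ x, x ∈ reach G {u} G.diam := fun x => mem_reach_of_dist_le hc rfl
    (SimpleGraph.dist_le_diam (SimpleGraph.connected_iff_ediam_ne_top.1 hc))
  have hc1 : (G.deleteEdges {e}).Connected := by
    simpa using connected_deleteEdges_pair hG e e
  have h1 : ∀ x, x ∈ reach (G.deleteEdges {e}) {u} (3 * G.diam + 1) := fun x =>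
    mem_reach_of_dist_le hc1 rfl <| le_of_dist_eq_of_avoid (e := e) hc1
      (fun a b h hne => by simp [h, hne]) (fun x _ => h0 x) rfl
  -- The second deletion gives `3 * (3 * D + 1) + 1 = 9 * D + 4`, at most `13 * D` since `D ≥ 1`.
  have h2 := le_of_dist_eq_of_avoid (e := f) (y := v) (connected_deleteEdges_pair hG e f)
    (G := G.deleteEdges {e})
    (fun a b h hne => by
      rw [SimpleGraph.deleteEdges_adj] at h ⊢
      simpa [hne] using h) (fun x _ => h1 x) rfl
  omega

lemma diam_le_two_mul [Finite V] [Nonempty V] {G : SimpleGraph V} (hG : G.Connected) {s : V}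
    {R : ℕ} (h : ∀ v, G.dist s v ≤ R) : G.diam ≤ 2 * R := by
  obtain ⟨u, v, huv⟩ := G.exists_dist_eq_diam
  have := hG.dist_triangle (u := u) (v := s) (w := v)
  have h1 := h u
  have h2 := h v
  rw [G.dist_comm] at h1
  omega

/-- If every vertex near `s` in `G - e - f` is joined to `s` by a short walk avoiding `f`, then
the whole graph is near `s`. -/
lemma dist_le_of_reach_deleteEdges [Nonempty V] {G : SimpleGraph V} (hG : G.IsEdgeConnected 3)
    (e f : Sym2 V) {s : V} {K : ℕ}
    (h : ∀ x, (G.deleteEdges {e, f}).dist s x ≤ 3 * K + 2 → x ∈ reach (G.deleteEdges {f}) {s} K)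
    (v : V) : G.dist s v ≤ 3 * K + 1 := by
  have hH := connected_deleteEdges_pair hG e f
  by_contra! hv
  have hle : G.dist s v ≤ (G.deleteEdges {e, f}).dist s v :=
    (hH s v).dist_anti (G.deleteEdges_le _)
  -- The first radius that `le_of_dist_eq_of_avoid` excludes; it only needs information on the ball
  -- of this radius.
  obtain ⟨y, hy⟩ := exists_dist_eq hH (u := s) (v := v) (n := 3 * K + 2) (by omega)
  have := le_of_dist_eq_of_avoid (e := e) (y := y) hH (G := G.deleteEdges {f})
    (fun a b h hne => by
      rw [SimpleGraph.deleteEdges_adj] at h ⊢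
      simpa [hne] using h) h hy
  omega

end Reach

/-! ### Broadcast schemes and the refinement of cut sets. -/

/-- The empty message, which only serves to wake up a neighbour. -/
def ping (b : ℕ) : Msg b := ⟨[], Nat.zero_le b⟩

/-- A broadcast scheme: a sequence of channels, each of which floods one bit of information from
a set of sources. `enc` encodes edge names, `len p` is the number of iterations of channel `p`,
`src inp p acc` says whether a node with input `inp` which has accepted in the channels `acc` is a
source of channel `p`, and `res p acc` is the decision before channel `p`. -/
structure Scheme (M b : ℕ) where
  enc : Option (Sym2 (Fin M)) → Msg b
  len : ℕ → ℕ
  src : LocalInput → ℕ → Set ℕ → Prop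
  res : ℕ → Set ℕ → Option (List Bool × ℕ)

/-- The state of a node. `cut` is a set of edges that contains the adversarial edge unless some
source of the current channel is reached by a walk that avoids this edge; `none` stands for the
set of all edges. `heard` collects what the neighbours have sent in the current iteration. -/
structure NodeState (M : ℕ) where
  inp : LocalInput
  chan : ℕ
  iter : ℕ
  tick : ℕ
  cut : Option (Finset (Sym2 (Fin M)))
  heard : Set (ℕ × Option (Sym2 (Fin M)))
  acc : Set ℕ

section Refine

variable {M : ℕ} [NeZero M]

/-- The cut sets offered by the own previous one and by those of the neighbours. -/
def cutCandidates (own i : ℕ) (X : Option (Finset (Sym2 (Fin M))))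
    (T : Set (ℕ × Option (Sym2 (Fin M)))) : Set (Finset (Sym2 (Fin M))) :=
  {Y | X = some Y} ∪ {Y | ∃ y Z, (y, none) ∈ T ∧ (∀ e, e ∈ Z ↔ (y, some e) ∈ T) ∧ Z.card ≤ i ∧
    Y = insert s(Fin.ofNat M own, Fin.ofNat M y) Z}

open Classical in
/-- The intersection of all the candidates. -/
noncomputable def refineCut (own i : ℕ) (X : Option (Finset (Sym2 (Fin M))))
    (T : Set (ℕ × Option (Sym2 (Fin M)))) : Option (Finset (Sym2 (Fin M))) :=
  if (cutCandidates own i X T).Nonempty then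
    some (Set.toFinite {e | ∀ Y ∈ cutCandidates own i X T, e ∈ Y}).toFinset
  else none

lemma exists_refineCut_of_mem {own i : ℕ} {X : Option (Finset (Sym2 (Fin M)))}
    {T : Set (ℕ × Option (Sym2 (Fin M)))} {Y : Finset (Sym2 (Fin M))}
    (hY : Y ∈ cutCandidates own i X T) : ∃ Z, refineCut own i X T = some Z ∧ Z ⊆ Y := by
  refine ⟨_, if_pos ⟨Y, hY⟩, fun e he => ?_⟩
  exact (Set.Finite.mem_toFinset _).1 he Y hY

lemma exists_candidate_of_notMem {own i : ℕ} {X : Option (Finset (Sym2 (Fin M)))}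
    {T : Set (ℕ × Option (Sym2 (Fin M)))} {Z : Finset (Sym2 (Fin M))} {e : Sym2 (Fin M)}
    (hZ : refineCut own i X T = some Z) (he : e ∉ Z) :
    ∃ Y ∈ cutCandidates own i X T, e ∉ Y := by
  unfold refineCut at hZ
  split_ifs at hZ with h
  obtain rfl := Option.some.inj hZ
  simpa using he

/-- Received sets with more than `i` elements are no candidates, so the adversary cannot inflate a
cut set beyond what fits into one iteration. -/
lemma card_le_of_refineCut {own i : ℕ} {X : Option (Finset (Sym2 (Fin M)))}
    {T : Set (ℕ × Option (Sym2 (Fin M)))} {Z : Finset (Sym2 (Fin M))}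
    (hX : ∀ Y, X = some Y → Y.card ≤ i) (hZ : refineCut own i X T = some Z) :
    Z.card ≤ i + 1 := by
  have hne : (cutCandidates own i X T).Nonempty := by
    by_contra h
    simp [refineCut, h] at hZ
  obtain ⟨Y, hY⟩ := hne
  obtain ⟨Z', hZ', hsub⟩ := exists_refineCut_of_mem hY
  obtain rfl := Option.some.inj (hZ.symm.trans hZ')
  refine (Finset.card_le_card hsub).trans ?_
  rcases hY with hY | ⟨y, W, -, -, hW, rfl⟩
  · exact (hX Y hY).trans (by omega)
  · exact (Finset.card_insert_le _ _).trans (by omega)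

end Refine

/-! ### The evolution of a single node in local time. -/

namespace Scheme

variable {M b : ℕ} (C : Scheme M b)

open Classical in
/-- The cut set with which a node enters channel `p`. -/
noncomputable def startCut (inp : LocalInput) (p : ℕ) (acc : Set ℕ) :
    Option (Finset (Sym2 (Fin M))) :=
  if C.src inp p acc then some ∅ else none

/-- The number of rounds of an iteration of channel `p`. The first and the last one are left idle
as the clocks of neighbours may differ by one round. -/
def width (p : ℕ) : ℕ := C.len p + 3

/-- What a node puts on its edges. -/
noncomputable def symbol (q : NodeState M) : Msg b :=
  match q.cut with
  | none => ping b
  -- Past the end of the list `getElem?` yields `none`, the end marker. There are `len + 1` slots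
  -- for at most `iter < len` elements, so the marker is always sent.
  | some X => if 1 ≤ q.tick ∧ q.tick ≤ C.len q.chan + 1 then C.enc (X.toList[q.tick - 1]?)
    else ping b

/-- The local time at which channel `p` starts. -/
def startTime : ℕ → ℕ
  | 0 => 0
  | p + 1 => startTime p + C.len p * C.width p

/-- The symbols received in the `t` rounds from round `n` on. -/
def heardIn (J : ℕ → Set (ℕ × Msg b)) (n t : ℕ) : Set (ℕ × Option (Sym2 (Fin M))) :=
  {a | ∃ c < t, (a.1, C.enc a.2) ∈ J (n + c)}

lemma heardIn_width (J : ℕ → Set (ℕ × Msg b)) (n p : ℕ) : C.heardIn J n (C.width p - 1) ∪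
    {a | (a.1, C.enc a.2) ∈ J (n + (C.width p - 1))} = C.heardIn J n (C.width p) := by
  have hw : C.width p = (C.width p - 1) + 1 := by simp [width]
  ext ⟨y, x⟩
  simp only [heardIn, Set.mem_union, Set.mem_ofPred_eq]
  rw [hw]
  simp only [Nat.lt_succ_iff_lt_or_eq, Nat.add_sub_cancel]
  grind

/-- Every local time lies in an iteration of a channel. -/
lemma exists_decomp (hlen : ∀ p, 0 < C.len p) (n : ℕ) : ∃ p i t, i < C.len p ∧ t < C.width p ∧
    n = C.startTime p + i * C.width p + t := by
  induction n with
  | zero => exact ⟨0, 0, 0, hlen 0, by simp [width], by simp [startTime]⟩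
  | succ n ih =>
    obtain ⟨p, i, t, hi, ht, rfl⟩ := ih
    by_cases h1 : t + 1 < C.width p
    · exact ⟨p, i, t + 1, hi, h1, rfl⟩
    have ht' : t + 1 = C.width p := by omega
    by_cases h2 : i + 1 < C.len p
    · exact ⟨p, i + 1, 0, h2, by simp [width], by rw [Nat.succ_mul]; omega⟩
    · refine ⟨p + 1, 0, 0, hlen _, by simp [width], ?_⟩
      rw [startTime, show C.len p = i + 1 by omega, Nat.succ_mul]
      omega

lemma startTime_mono : Monotone C.startTime :=
  monotone_nat_of_le_succ fun _ => Nat.le_add_right _ _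

variable [NeZero M]

/-- The state change of a node in one round. -/
noncomputable def step (q : NodeState M) (J : Set (ℕ × Msg b)) : NodeState M :=
  let T := q.heard ∪ {a | (a.1, C.enc a.2) ∈ J}
  if q.tick + 1 < C.width q.chan then { q with tick := q.tick + 1, heard := T }
  else
    let X := refineCut q.inp.ownId q.iter q.cut T
    if q.iter + 1 < C.len q.chan then
      { q with tick := 0, iter := q.iter + 1, heard := ∅, cut := X }
    else
      let acc := q.acc ∪ {r | r = q.chan ∧ X = some ∅}
      ⟨q.inp, q.chan + 1, 0, 0, C.startCut q.inp (q.chan + 1) acc, ∅, acc⟩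

/-- The protocol that runs the channels one after the other. -/
noncomputable def protocol : Protocol b where
  State := NodeState M
  init inp := ⟨inp, 0, 0, 0, C.startCut inp 0 ∅, ∅, ∅⟩
  send q _ := some (C.symbol q)
  recv := C.step
  output q := C.res q.chan q.acc

/-- The states of a node that receives the messages `J 0`, `J 1`, … and never halts. -/
noncomputable def localRun (inp : LocalInput) (J : ℕ → Set (ℕ × Msg b)) : ℕ → NodeState M
  | 0 => ⟨inp, 0, 0, 0, C.startCut inp 0 ∅, ∅, ∅⟩
  | n + 1 => C.step (localRun inp J n) (J n)

variable (inp : LocalInput) (J : ℕ → Set (ℕ × Msg b))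

/-- The channels before `p` in which a node has accepted. -/
noncomputable def accAt (p : ℕ) : Set ℕ := (C.localRun inp J (C.startTime p)).acc

/-- The cut set after `i` iterations of channel `p`. -/
noncomputable def cutAt (p : ℕ) : ℕ → Option (Finset (Sym2 (Fin M)))
  | 0 => C.startCut inp p (C.accAt inp J p)
  | i + 1 => refineCut inp.ownId i (cutAt p i)
      (C.heardIn J (C.startTime p + i * C.width p) (C.width p))

variable {inp J}

lemma localRun_add {n p i : ℕ} {X : Option (Finset (Sym2 (Fin M)))} {acc : Set ℕ}
    (h : C.localRun inp J n = ⟨inp, p, i, 0, X, ∅, acc⟩) {t : ℕ} (ht : t < C.width p) :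
    C.localRun inp J (n + t) = ⟨inp, p, i, t, X, C.heardIn J n t, acc⟩ := by
  induction t with
  | zero =>
    rw [Nat.add_zero, h]
    simp [heardIn]
  | succ t ih =>
    rw [← Nat.add_assoc, localRun, ih (by omega)]
    simp only [step, ht, if_true]
    congr 1
    ext ⟨y, x⟩
    simp only [heardIn, Set.mem_union, Set.mem_ofPred_eq, Nat.lt_succ_iff_lt_or_eq]
    grind

lemma localRun_add_width {n p i : ℕ} {X : Option (Finset (Sym2 (Fin M)))} {acc : Set ℕ}
    (h : C.localRun inp J n = ⟨inp, p, i, 0, X, ∅, acc⟩) :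
    C.localRun inp J (n + C.width p) = C.step
      ⟨inp, p, i, C.width p - 1, X, C.heardIn J n (C.width p - 1), acc⟩
        (J (n + (C.width p - 1))) := by
  have hw : C.width p = (C.width p - 1) + 1 := by simp [width]
  conv_lhs => rw [hw, ← Nat.add_assoc, localRun, C.localRun_add h (by omega)]

lemma localRun_iter_of_start {p : ℕ}
    (h : C.localRun inp J (C.startTime p) = ⟨inp, p, 0, 0, C.cutAt inp J p 0, ∅, C.accAt inp J p⟩)
    {i : ℕ} (hi : i < C.len p) : C.localRun inp J (C.startTime p + i * C.width p) =
      ⟨inp, p, i, 0, C.cutAt inp J p i, ∅, C.accAt inp J p⟩ := by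
  induction i with
  | zero => simpa using h
  | succ i ih =>
    rw [Nat.succ_mul, ← Nat.add_assoc, C.localRun_add_width (ih (by omega))]
    have hw : C.width p - 1 + 1 = C.width p := by simp [width]
    simp only [step, hw, lt_irrefl, if_false, hi, if_true, heardIn_width, cutAt]

lemma localRun_next_of_start (hlen : ∀ p, 0 < C.len p) {p : ℕ}
    (h : C.localRun inp J (C.startTime p) = ⟨inp, p, 0, 0, C.cutAt inp J p 0, ∅, C.accAt inp J p⟩) :
    C.localRun inp J (C.startTime (p + 1)) =
      (let acc := C.accAt inp J p ∪ {r | r = p ∧ C.cutAt inp J p (C.len p) = some ∅}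
      ⟨inp, p + 1, 0, 0, C.startCut inp (p + 1) acc, ∅, acc⟩) := by
  obtain ⟨l, hl⟩ : ∃ l, C.len p = l + 1 := ⟨C.len p - 1, by have := hlen p; omega⟩
  have := C.localRun_iter_of_start h (i := l) (by omega)
  rw [startTime, hl, Nat.succ_mul, ← Nat.add_assoc, C.localRun_add_width this]
  have hw : C.width p - 1 + 1 = C.width p := by simp [width]
  simp only [step, hw, lt_irrefl, if_false, hl, heardIn_width, cutAt]

lemma localRun_startTime (hlen : ∀ p, 0 < C.len p) (p : ℕ) : C.localRun inp J (C.startTime p) =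
    ⟨inp, p, 0, 0, C.cutAt inp J p 0, ∅, C.accAt inp J p⟩ := by
  induction p with
  | zero => rfl
  | succ p ih =>
    have := C.localRun_next_of_start hlen ih
    rw [cutAt, accAt, this]

/-- The state of a node in round `t` of iteration `i` of channel `p`. -/
lemma localRun_eq (hlen : ∀ p, 0 < C.len p) {p i t : ℕ} (hi : i < C.len p) (ht : t < C.width p) :
    C.localRun inp J (C.startTime p + i * C.width p + t) = ⟨inp, p, i, t, C.cutAt inp J p i,
      C.heardIn J (C.startTime p + i * C.width p) t, C.accAt inp J p⟩ :=
  C.localRun_add (C.localRun_iter_of_start (C.localRun_startTime hlen p) hi) ht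

lemma mem_accAt_succ (hlen : ∀ p, 0 < C.len p) {p r : ℕ} : r ∈ C.accAt inp J (p + 1) ↔
    r ∈ C.accAt inp J p ∨ r = p ∧ C.cutAt inp J p (C.len p) = some ∅ := by
  rw [accAt, C.localRun_next_of_start hlen (C.localRun_startTime hlen p)]
  rfl

lemma card_cutAt_le {p i : ℕ} {X : Finset (Sym2 (Fin M))} (h : C.cutAt inp J p i = some X) :
    X.card ≤ i := by
  induction i generalizing X with
  | zero =>
    rw [cutAt, startCut] at h
    split_ifs at h
    simp [← Option.some.inj h]
  | succ i ih => exact card_le_of_refineCut (fun Y hY => ih hY) h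

end Scheme

/-! ### Wake-up, synchronisation and halting. -/

/-- An execution of the protocol of `C` in which all edges but `e` deliver faithfully. -/
structure Execution {V : Type*} [Fintype V] {M b : ℕ} [NeZero M] (C : Scheme M b)
    (G : SimpleGraph V) (ident : V → ℕ) (s : V) (m₀ : List Bool) (e : Sym2 V) where
  cfg : ℕ → V → Option (NodeState M)
  traffic : ℕ → Traffic V b
  cfg_zero_source : cfg 0 s = some (C.protocol.init (localInput G ident s m₀ s))
  cfg_zero_of_ne : ∀ v, v ≠ s → cfg 0 v = none
  cfg_succ : ∀ t v, cfg (t + 1) v = nextState C.protocol (localInput G ident s m₀ v)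
    (inbox G ident (traffic t) v) (cfg t v)
  faithful : ∀ t u v, s(u, v) ≠ e → traffic t u v = sent C.protocol ident (cfg t) u v

namespace Execution

variable {V : Type*} [Fintype V] {M b : ℕ} [NeZero M] {C : Scheme M b}
  {G : SimpleGraph V} {ident : V → ℕ} {s : V} {m₀ : List Bool} {e : Sym2 V}
  (X : Execution C G ident s m₀ e)

/-- The round in which `v` is woken up. -/
noncomputable def wake (v : V) : ℕ := sInf {t | X.cfg (t + 1) v ≠ none}

/-- The messages received by `v` after its wake-up. -/
def stream (v : V) (n : ℕ) : Set (ℕ × Msg b) := inbox G ident (X.traffic (X.wake v + n)) v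

/-- The state of `v` at local time `n`, if it has not halted. -/
noncomputable def loc (v : V) (n : ℕ) : NodeState M :=
  C.localRun (localInput G ident s m₀ v) (X.stream v) n

/-- The channels before `p` in which `v` has accepted. -/
noncomputable def acc (v : V) (p : ℕ) : Set ℕ :=
  C.accAt (localInput G ident s m₀ v) (X.stream v) p

/-- The cut set of `v` after `i` iterations of channel `p`. -/
noncomputable def cut (v : V) (p i : ℕ) : Option (Finset (Sym2 (Fin M))) :=
  C.cutAt (localInput G ident s m₀ v) (X.stream v) p i

/-- The sources of channel `p`. -/
def sources (p : ℕ) : Set V := {v | C.src (localInput G ident s m₀ v) p (X.acc v p)}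

/-- No node has halted before the end of channel `p`. -/
def Quiet (p : ℕ) : Prop := ∀ v, ∀ p' ≤ p, C.res p' (X.acc v p') = none

lemma nextState_ne_none {P : Protocol b} {inp : LocalInput} {I : Set (ℕ × Msg b)}
    {c : Option P.State} (h : c ≠ none ∨ I ≠ ∅) : nextState P inp I c ≠ none := by
  cases c with
  | none => simp_all [nextState]
  | some q =>
    unfold nextState
    cases hq : P.output q <;> simp [hq]

lemma wake_le {v : V} {t : ℕ} (h : X.cfg (t + 1) v ≠ none) : X.wake v ≤ t := Nat.sInf_le h

lemma cfg_source_one_ne_none : X.cfg 1 s ≠ none := by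
  rw [X.cfg_succ 0 s]
  exact nextState_ne_none (Or.inl (by simp [X.cfg_zero_source]))

lemma wake_source : X.wake s = 0 := Nat.le_zero.1 (X.wake_le X.cfg_source_one_ne_none)

lemma cfg_eq_none {v : V} (hv : v ≠ s) {t : ℕ} (ht : t ≤ X.wake v) : X.cfg t v = none := by
  cases t with
  | zero => exact X.cfg_zero_of_ne v hv
  | succ t => exact not_not.1 (Nat.notMem_of_lt_sInf (s := {t | X.cfg (t + 1) v ≠ none}) ht)

/-- Apart from the source, a node is still asleep at its local time `0`, so true and local states
are compared only from local time `1` on. -/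
lemma cfg_eq_loc (h0 : ∀ A, C.res 0 A = none) {v : V} (hw : X.cfg (X.wake v + 1) v ≠ none) {n : ℕ}
    (h : ∀ n' ≤ n, C.protocol.output (X.loc v n') = none) :
    X.cfg (X.wake v + (n + 1)) v = some (X.loc v (n + 1)) := by
  induction n with
  | zero =>
    by_cases hv : v = s
    · subst hv
      rw [Nat.zero_add, X.cfg_succ, X.wake_source, X.cfg_zero_source]
      have : C.protocol.output (C.protocol.init (localInput G ident v m₀ v)) = none := h0 _
      simp only [nextState, this]
      simp only [loc, Scheme.localRun, stream, X.wake_source]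
      rfl
    · rw [Nat.zero_add]
      rw [X.cfg_succ, X.cfg_eq_none hv le_rfl] at hw ⊢
      simp only [nextState] at hw ⊢
      split_ifs at hw ⊢ with hI
      · exact absurd rfl hw
      · rfl
  | succ n ih =>
    rw [← Nat.add_assoc, X.cfg_succ, ih fun n' hn' => h n' (by omega)]
    simp only [nextState, h (n + 1) le_rfl]
    rfl

lemma loc_eq (hlen : ∀ p, 0 < C.len p) (v : V) {p i t : ℕ} (hi : i < C.len p)
    (ht : t < C.width p) : X.loc v (C.startTime p + i * C.width p + t) =
      ⟨localInput G ident s m₀ v, p, i, t, X.cut v p i,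
        C.heardIn (X.stream v) (C.startTime p + i * C.width p) t, X.acc v p⟩ :=
  C.localRun_eq hlen hi ht

lemma mem_acc_succ (hlen : ∀ p, 0 < C.len p) {v : V} {p r : ℕ} : r ∈ X.acc v (p + 1) ↔
    r ∈ X.acc v p ∨ r = p ∧ X.cut v p (C.len p) = some ∅ :=
  C.mem_accAt_succ hlen

lemma mem_acc_iff (hlen : ∀ p, 0 < C.len p) {v : V} {p r : ℕ} :
    r ∈ X.acc v p ↔ r < p ∧ X.cut v r (C.len r) = some ∅ := by
  induction p with
  | zero => simp [acc, Scheme.accAt, Scheme.startTime, Scheme.localRun]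
  | succ p ih =>
    rw [X.mem_acc_succ hlen, ih]
    grind

lemma exists_loc_start (hlen : ∀ p, 0 < C.len p) (v : V) (p : ℕ) :
    (X.loc v (C.startTime p)).chan = p ∧ (X.loc v (C.startTime p)).acc = X.acc v p := by
  have := X.loc_eq hlen v (hlen p) (t := 0) (by simp [Scheme.width])
  simp only [Nat.zero_mul, Nat.add_zero] at this
  simp [this]

/-- Up to the end of a quiet channel no node halts. -/
lemma Quiet.output_eq_none (hlen : ∀ p, 0 < C.len p) {p : ℕ} {v : V}
    (hq : ∀ p' ≤ p, C.res p' (X.acc v p') = none) {n : ℕ} (hn : n < C.startTime (p + 1)) :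
    C.protocol.output (X.loc v n) = none := by
  obtain ⟨p', i, t, hi, ht, rfl⟩ := C.exists_decomp hlen n
  rw [X.loc_eq hlen v hi ht]
  refine hq p' ?_
  by_contra! hp
  have : C.startTime (p + 1) ≤ C.startTime p' := C.startTime_mono hp
  omega

/-- An active node always sends at least a ping, and channel `0` is too long for anybody to halt at
once. -/
lemma sent_ne_none (h0 : ∀ A, C.res 0 A = none) (hlen : ∀ p, 0 < C.len p) {u : V}
    (hw : X.cfg (X.wake u + 1) u ≠ none) (v : V) :
    sent C.protocol ident (X.cfg (X.wake u + 1)) u v ≠ none := by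
  have hout : ∀ n < 2, C.protocol.output (X.loc u n) = none := by
    intro n hn
    refine Quiet.output_eq_none X hlen (p := 0) (fun p' hp' => ?_) ?_
    · rw [Nat.le_zero.1 hp']
      exact h0 _
    · have := hlen 0
      simp only [Scheme.startTime, Scheme.width]
      nlinarith
  have := X.cfg_eq_loc h0 hw (n := 0) fun n' hn' => hout n' (by omega)
  rw [Nat.zero_add] at this
  unfold sent
  rw [this]
  simp only [hout 1 (by omega)]
  exact Option.some_ne_none _

lemma cfg_ne_none_of_adj (h0 : ∀ A, C.res 0 A = none) (hlen : ∀ p, 0 < C.len p) {u v : V}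
    (hw : X.cfg (X.wake u + 1) u ≠ none) (huv : (G.deleteEdges {e}).Adj u v) :
    X.cfg (X.wake u + 2) v ≠ none := by
  rw [SimpleGraph.deleteEdges_adj] at huv
  obtain ⟨x, hx⟩ := Option.ne_none_iff_exists'.1 (X.sent_ne_none h0 hlen hw v)
  rw [X.cfg_succ]
  refine nextState_ne_none (Or.inr (Set.Nonempty.ne_empty ⟨(ident u, x), u, huv.1, rfl, ?_⟩))
  rw [X.faithful _ _ _ (by simpa using huv.2), hx]

/-- The faithful edges wake up every node in time. -/
lemma exists_cfg_ne_none (h0 : ∀ A, C.res 0 A = none) (hlen : ∀ p, 0 < C.len p) {v : V} {n : ℕ}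
    (h : v ∈ reach (G.deleteEdges {e}) {s} n) : ∃ t ≤ n, X.cfg (t + 1) v ≠ none := by
  induction n generalizing v with
  | zero =>
    obtain rfl : v = s := h
    exact ⟨0, le_rfl, X.cfg_source_one_ne_none⟩
  | succ n ih =>
    rcases h with h | ⟨u, hu, huv⟩
    · obtain ⟨t, ht, h⟩ := ih h
      exact ⟨t, by omega, h⟩
    · obtain ⟨t, ht, h⟩ := ih hu
      have hm : X.wake u ∈ {t | X.cfg (t + 1) u ≠ none} := Nat.sInf_mem ⟨t, h⟩
      exact ⟨X.wake u + 1, by have := X.wake_le h; omega, X.cfg_ne_none_of_adj h0 hlen hm huv⟩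

lemma wake_le_of_reach (h0 : ∀ A, C.res 0 A = none) (hlen : ∀ p, 0 < C.len p) {v : V} {n : ℕ}
    (h : v ∈ reach (G.deleteEdges {e}) {s} n) : X.wake v ≤ n := by
  obtain ⟨t, ht, h⟩ := X.exists_cfg_ne_none h0 hlen h
  exact (X.wake_le h).trans ht

lemma cfg_wake_ne_none (h0 : ∀ A, C.res 0 A = none) (hlen : ∀ p, 0 < C.len p)
    (hG : (G.deleteEdges {e}).Connected) (v : V) : X.cfg (X.wake v + 1) v ≠ none := by
  obtain ⟨t, -, h⟩ := X.exists_cfg_ne_none h0 hlen (mem_reach_of_dist_le hG (Set.mem_singleton s)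
    (le_refl ((G.deleteEdges {e}).dist s v)))
  exact Nat.sInf_mem (s := {t | X.cfg (t + 1) v ≠ none}) ⟨t, h⟩

/-- The clocks of neighbours differ by at most one round. -/
lemma wake_le_of_adj (h0 : ∀ A, C.res 0 A = none) (hlen : ∀ p, 0 < C.len p)
    (hG : (G.deleteEdges {e}).Connected) {u v : V} (huv : (G.deleteEdges {e}).Adj u v) :
    X.wake v ≤ X.wake u + 1 :=
  X.wake_le (X.cfg_ne_none_of_adj h0 hlen (X.cfg_wake_ne_none h0 hlen hG u) huv)

lemma cfg_halted {v : V} {t : ℕ} {q : NodeState M} {o : List Bool × ℕ} (h : X.cfg t v = some q)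
    (ho : C.protocol.output q = some o) (r : ℕ) : X.cfg (t + r) v = some q := by
  induction r with
  | zero => exact h
  | succ r ih =>
    rw [← Nat.add_assoc, X.cfg_succ, ih]
    simp only [nextState, ho]
    rfl

/-- A node whose decision is made before channel `p` has halted when this channel starts. -/
lemma exists_cfg_of_res (h0 : ∀ A, C.res 0 A = none) (hlen : ∀ p, 0 < C.len p)
    (hG : (G.deleteEdges {e}).Connected) {v : V} {p : ℕ}
    (hq : ∀ p' ≤ p, C.res p' (X.acc v p') = none) {o : List Bool × ℕ}
    (ho : C.res (p + 1) (X.acc v (p + 1)) = some o) {t : ℕ}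
    (ht : X.wake v + C.startTime (p + 1) ≤ t) :
    ∃ q, X.cfg t v = some q ∧ C.protocol.output q = some o := by
  have hpos : 0 < C.startTime (p + 1) := by
    have := hlen p
    simp only [Scheme.startTime, Scheme.width]
    positivity
  obtain ⟨n, hn⟩ : ∃ n, C.startTime (p + 1) = n + 1 := ⟨C.startTime (p + 1) - 1, by omega⟩
  have h := X.cfg_eq_loc h0 (X.cfg_wake_ne_none h0 hlen hG v) (n := n) fun n' hn' =>
    Quiet.output_eq_none X hlen hq (by omega)
  rw [← hn] at h
  have hout : C.protocol.output (X.loc v (C.startTime (p + 1))) = some o := by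
    obtain ⟨h1, h2⟩ := X.exists_loc_start hlen v (p + 1)
    change C.res (X.loc v (C.startTime (p + 1))).chan (X.loc v (C.startTime (p + 1))).acc = _
    rw [h1, h2, ho]
  obtain ⟨r, rfl⟩ := Nat.exists_eq_add_of_le ht
  exact ⟨_, X.cfg_halted h hout r, hout⟩

end Execution

/-! ### Soundness and completeness of a channel. -/

/-- The requirements on a scheme under which its channels work. -/
structure Scheme.Valid {M b : ℕ} (C : Scheme M b) : Prop where
  res_zero : ∀ A, C.res 0 A = none
  len_pos : ∀ p, 0 < C.len p
  enc_inj : Function.Injective C.enc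
  enc_ne_ping : ∀ x, C.enc x ≠ ping b

/-- Iterations are disjoint intervals of local time, and a time that is neither the first nor the
last of its interval stays inside when shifted by one. -/
lemma Scheme.eq_of_overlap {M b : ℕ} (C : Scheme M b) {p i p' i' n : ℕ} (hi : i < C.len p)
    (hi' : i' < C.len p') (h1 : C.startTime p + i * C.width p ≤ n + 1)
    (h2 : n ≤ C.startTime p + i * C.width p + C.width p)
    (h3 : C.startTime p' + i' * C.width p' + 1 ≤ n)
    (h4 : n + 2 ≤ C.startTime p' + i' * C.width p' + C.width p') : p = p' ∧ i = i' := by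
  have key : ∀ {p i p' : ℕ}, i < C.len p → p < p' →
      C.startTime p + i * C.width p + C.width p ≤ C.startTime p' := by
    intro p i p' hi hp
    calc C.startTime p + i * C.width p + C.width p = C.startTime p + (i + 1) * C.width p := by ring
      _ ≤ C.startTime p + C.len p * C.width p := by gcongr; omega
      _ ≤ C.startTime p' := C.startTime_mono (show p + 1 ≤ p' from hp)
  have key' : ∀ {p i i' : ℕ}, i < i' →
      C.startTime p + i * C.width p + C.width p ≤ C.startTime p + i' * C.width p := by
    intro p i i' hi
    calc C.startTime p + i * C.width p + C.width p = C.startTime p + (i + 1) * C.width p := by ring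
      _ ≤ _ := by gcongr; omega
  rcases lt_trichotomy p p' with h | rfl | h
  · have := key hi h
    omega
  · refine ⟨rfl, ?_⟩
    rcases lt_trichotomy i i' with h | h | h
    · have := key' (p := p) h
      omega
    · exact h
    · have := key' (p := p) h
      omega
  · have := key hi' h
    omega

lemma mem_inbox_iff {V : Type*} {b : ℕ} {G : SimpleGraph V} {ident : V → ℕ}
    (hinj : Function.Injective ident) {y : Traffic V b} {u v : V}
    (huv : G.Adj u v) {w : Msg b} : (ident u, w) ∈ inbox G ident y v ↔ y u v = some w := by
  constructor
  · rintro ⟨u', -, h, h'⟩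
    rwa [hinj h]
  · exact fun h => ⟨u, huv, rfl, h⟩

/-- The name of a vertex. -/
def name {V : Type*} (M : ℕ) [NeZero M] (ident : V → ℕ) (v : V) : Fin M := Fin.ofNat M (ident v)

lemma name_injective {V : Type*} {M : ℕ} [NeZero M] {ident : V → ℕ}
    (hinj : Function.Injective ident) (hM : ∀ v, ident v < M) :
    Function.Injective (name M ident) := by
  intro u v h
  have := congrArg Fin.val h
  simp only [name, Fin.val_ofNat, Nat.mod_eq_of_lt (hM _)] at this
  exact hinj this

namespace Execution

variable {V : Type*} [Fintype V] {M b : ℕ} [NeZero M] {C : Scheme M b}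
  {G : SimpleGraph V} {ident : V → ℕ} {s : V} {m₀ : List Bool} {e : Sym2 V}
  (X : Execution C G ident s m₀ e)

/-- A proper symbol is sent in the middle of an iteration only. -/
lemma of_symbol_eq (hC : C.Valid) {u : V} {n : ℕ} {x : Option (Sym2 (Fin M))}
    (h : C.symbol (X.loc u n) = C.enc x) : ∃ p i j Z, i < C.len p ∧ j ≤ C.len p ∧
      n = C.startTime p + i * C.width p + (j + 1) ∧ X.cut u p i = some Z ∧ Z.toList[j]? = x := by
  obtain ⟨p, i, t, hi, ht, rfl⟩ := C.exists_decomp hC.len_pos n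
  rw [X.loc_eq hC.len_pos u hi ht] at h
  unfold Scheme.symbol at h
  dsimp only at h
  cases hZ : X.cut u p i with
  | none => exact absurd (by simpa [hZ] using h.symm) (hC.enc_ne_ping x)
  | some Z =>
    simp only [hZ] at h
    split_ifs at h with hcond
    · obtain ⟨j, rfl⟩ : ∃ j, t = j + 1 := ⟨t - 1, by omega⟩
      exact ⟨p, i, j, Z, hi, by omega, rfl, hZ, hC.enc_inj h⟩
    · exact absurd h.symm (hC.enc_ne_ping x)

/-- The range of `t` goes one round past the end of channel `p` on the clock of `u`, as the receiver
may be one round late. -/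
lemma of_sent_eq (hC : C.Valid) (hG : (G.deleteEdges {e}).Connected) {p : ℕ} (hq : X.Quiet p)
    {u v : V} {t : ℕ} (ht : t ≤ X.wake u + C.startTime (p + 1)) {x : Option (Sym2 (Fin M))}
    (h : sent C.protocol ident (X.cfg t) u v = some (C.enc x)) :
    ∃ n, t = X.wake u + n ∧ C.symbol (X.loc u n) = C.enc x := by
  have aux : ∀ q, X.cfg t u = some q → C.symbol q = C.enc x := by
    intro q hcfg
    unfold sent at h
    rw [hcfg] at h
    cases ho : C.protocol.output q with
    | none =>
      simp only [ho] at h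
      exact Option.some.inj h
    | some o => simp [ho] at h
  rcases le_or_gt t (X.wake u) with htw | htw
  · by_cases hu : u = s
    · subst hu
      rw [X.wake_source] at htw
      obtain rfl := Nat.le_zero.1 htw
      exact ⟨0, by rw [X.wake_source], aux _ X.cfg_zero_source⟩
    · simp [sent, X.cfg_eq_none hu htw] at h
  · obtain ⟨n, rfl⟩ : ∃ n, t = X.wake u + (n + 1) := ⟨t - X.wake u - 1, by omega⟩
    refine ⟨n + 1, rfl, aux _ ?_⟩
    exact X.cfg_eq_loc hC.res_zero (X.cfg_wake_ne_none hC.res_zero hC.len_pos hG u) fun n' hn' =>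
      Quiet.output_eq_none X hC.len_pos (hq u) (by omega)

lemma sent_eq (hC : C.Valid) (hG : (G.deleteEdges {e}).Connected) {p : ℕ} (hq : X.Quiet p)
    {u v : V} {n : ℕ} (hn : n + 1 < C.startTime (p + 1)) :
    sent C.protocol ident (X.cfg (X.wake u + (n + 1))) u v =
      some (C.symbol (X.loc u (n + 1))) := by
  have h := X.cfg_eq_loc hC.res_zero (X.cfg_wake_ne_none hC.res_zero hC.len_pos hG u) (n := n)
    fun n' hn' => Quiet.output_eq_none X hC.len_pos (hq u) (by omega)
  unfold sent
  rw [h]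
  simp only [Quiet.output_eq_none X hC.len_pos (hq u) hn]
  rfl

/-- What `v` hears from its neighbours in iteration `i` of channel `p`. -/
def heard (v : V) (p i : ℕ) : Set (ℕ × Option (Sym2 (Fin M))) :=
  C.heardIn (X.stream v) (C.startTime p + i * C.width p) (C.width p)

lemma cut_succ (v : V) (p i : ℕ) :
    X.cut v p (i + 1) = refineCut (ident v) i (X.cut v p i) (X.heard v p i) := rfl

/-- Over a faithful edge a node hears the cut set of its neighbour. -/
lemma mem_heard_iff (hC : C.Valid) (hG : (G.deleteEdges {e}).Connected)
    (hinj : Function.Injective ident) {p : ℕ} (hq : X.Quiet p) {u v : V}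
    (huv : (G.deleteEdges {e}).Adj u v) {i : ℕ} (hi : i < C.len p)
    {x : Option (Sym2 (Fin M))} : (ident u, x) ∈ X.heard v p i ↔
      ∃ Z j, X.cut u p i = some Z ∧ j ≤ C.len p ∧ Z.toList[j]? = x := by
  have w1 := X.wake_le_of_adj hC.res_zero hC.len_pos hG huv
  have w2 := X.wake_le_of_adj hC.res_zero hC.len_pos hG huv.symm
  have huv' := huv
  rw [SimpleGraph.deleteEdges_adj, Set.mem_singleton_iff] at huv'
  have hend : C.startTime p + i * C.width p + C.width p ≤ C.startTime (p + 1) := by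
    calc C.startTime p + i * C.width p + C.width p = C.startTime p + (i + 1) * C.width p := by ring
      _ ≤ C.startTime p + C.len p * C.width p := by gcongr; omega
  have hwidth : C.width p = C.len p + 3 := rfl
  constructor
  · rintro ⟨c, hc, h⟩
    rw [stream, mem_inbox_iff hinj huv'.1, X.faithful _ _ _ huv'.2] at h
    obtain ⟨n, hn, hsym⟩ := X.of_sent_eq hC hG hq (by omega) h
    obtain ⟨p', i', j, Z, hi', hj, hn', hZ, hx⟩ := X.of_symbol_eq hC hsym
    have hwidth' : C.width p' = C.len p' + 3 := rfl
    obtain ⟨rfl, rfl⟩ := C.eq_of_overlap (n := n) hi hi' (by omega) (by omega) (by omega) (by omega)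
    exact ⟨Z, j, hZ, hj, hx⟩
  · rintro ⟨Z, j, hZ, hj, rfl⟩
    have hs := X.sent_eq hC hG hq (u := u) (v := v)
      (n := C.startTime p + i * C.width p + j) (by omega)
    rw [Nat.add_assoc _ j 1, X.loc_eq hC.len_pos u hi (t := j + 1) (by omega)] at hs
    simp only [Scheme.symbol, hZ, Nat.add_sub_cancel] at hs
    rw [if_pos (by omega)] at hs
    -- The arrival time on the receiver's clock. The idle first round keeps the subtraction from
    -- truncating, the idle last one keeps the result below the width.
    refine ⟨X.wake u + (j + 1) - X.wake v, by omega, ?_⟩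
    rw [stream, mem_inbox_iff hinj huv'.1, X.faithful _ _ _ huv'.2, ← hs]
    congr 2
    omega

lemma mem_heard_none_iff (hC : C.Valid) (hG : (G.deleteEdges {e}).Connected)
    (hinj : Function.Injective ident) {p : ℕ} (hq : X.Quiet p) {u v : V}
    (huv : (G.deleteEdges {e}).Adj u v) {i : ℕ} (hi : i < C.len p) :
    (ident u, none) ∈ X.heard v p i ↔ ∃ Z, X.cut u p i = some Z := by
  rw [X.mem_heard_iff hC hG hinj hq huv hi]
  constructor
  · rintro ⟨Z, -, hZ, -⟩
    exact ⟨Z, hZ⟩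
  · rintro ⟨Z, hZ⟩
    have hcard : Z.card ≤ i := C.card_cutAt_le hZ
    exact ⟨Z, C.len p, hZ, le_rfl, List.getElem?_eq_none (by rw [Finset.length_toList]; omega)⟩

lemma mem_heard_some_iff (hC : C.Valid) (hG : (G.deleteEdges {e}).Connected)
    (hinj : Function.Injective ident) {p : ℕ} (hq : X.Quiet p) {u v : V}
    (huv : (G.deleteEdges {e}).Adj u v) {i : ℕ} (hi : i < C.len p) {Z : Finset (Sym2 (Fin M))}
    (hZ : X.cut u p i = some Z) (f : Sym2 (Fin M)) :
    (ident u, some f) ∈ X.heard v p i ↔ f ∈ Z := by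
  rw [X.mem_heard_iff hC hG hinj hq huv hi]
  have hcard : Z.card ≤ i := C.card_cutAt_le hZ
  constructor
  · rintro ⟨Z', j, hZ', -, h⟩
    obtain rfl := Option.some.inj (hZ.symm.trans hZ')
    exact Finset.mem_toList.1 (List.mem_of_getElem? h)
  · intro hf
    obtain ⟨j, hj⟩ := List.mem_iff_getElem?.1 (Finset.mem_toList.2 hf)
    have hlt : j < Z.toList.length := (List.getElem?_eq_some_iff.1 hj).1
    rw [Finset.length_toList] at hlt
    exact ⟨Z, j, hZ, by omega, hj⟩

/-- A cut set without the adversarial edge certifies a walk from a source avoiding this edge. -/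
lemma mem_reach_of_notMem_cut (hC : C.Valid) (hG : (G.deleteEdges {e}).Connected)
    (hinj : Function.Injective ident) {p : ℕ} (hq : X.Quiet p)
    {i : ℕ} (hi : i ≤ C.len p) {v : V} {Z : Finset (Sym2 (Fin M))} (hZ : X.cut v p i = some Z)
    (he : e.map (name M ident) ∉ Z) : v ∈ reach (G.deleteEdges {e}) (X.sources p) i := by
  induction i generalizing v Z with
  | zero =>
    simp only [cut, Scheme.cutAt, Scheme.startCut] at hZ
    split_ifs at hZ with h
    exact h
  | succ i ih =>
    rw [X.cut_succ] at hZ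
    obtain ⟨Y, hY, heY⟩ := exists_candidate_of_notMem hZ he
    rcases hY with hY | ⟨y, W, hy, hW, -, rfl⟩
    · exact Or.inl (ih (by omega) hY heY)
    · obtain ⟨c, -, u, huv, rfl, -⟩ := id hy
      -- A set offered over `e` would contain `e`, inserted by the receiver.
      have hne : s(u, v) ≠ e := by
        rintro rfl
        apply heY
        rw [Sym2.map_mk, Sym2.eq_swap]
        exact Finset.mem_insert_self _ _
      have hadj : (G.deleteEdges {e}).Adj u v := by
        rw [SimpleGraph.deleteEdges_adj, Set.mem_singleton_iff]
        exact ⟨huv, hne⟩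
      obtain ⟨Z', hZ'⟩ := (X.mem_heard_none_iff hC hG hinj hq hadj (by omega)).1 hy
      refine Or.inr ⟨u, ih (by omega) hZ' fun h => heY ?_, hadj⟩
      refine Finset.mem_insert_of_mem ((hW _).2 ?_)
      exact (X.mem_heard_some_iff hC hG hinj hq hadj (by omega) hZ' _).2 h

/-- A walk from a source that avoids `e` and the edge named `x` removes `x` from the cut set. -/
lemma exists_cut_notMem (hC : C.Valid) (hG : (G.deleteEdges {e}).Connected)
    (hinj : Function.Injective ident) {p : ℕ} (hq : X.Quiet p) {H : SimpleGraph V}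
    (hH : H ≤ G.deleteEdges {e}) {x : Sym2 (Fin M)}
    (hx : ∀ u v, H.Adj u v → s(name M ident u, name M ident v) ≠ x)
    {i : ℕ} (hi : i ≤ C.len p) {v : V} (hv : v ∈ reach H (X.sources p) i) :
    ∃ Z, X.cut v p i = some Z ∧ x ∉ Z := by
  induction i generalizing v with
  | zero => exact ⟨∅, if_pos hv, Finset.notMem_empty x⟩
  | succ i ih =>
    rw [X.cut_succ]
    rcases hv with hv | ⟨u, hu, huv⟩
    · obtain ⟨Z, hZ, hxZ⟩ := ih (by omega) hv
      obtain ⟨Z', hZ', hsub⟩ := exists_refineCut_of_mem (own := ident v) (i := i)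
        (T := X.heard v p i) (Or.inl hZ)
      exact ⟨Z', hZ', fun h => hxZ (hsub h)⟩
    · obtain ⟨Z, hZ, hxZ⟩ := ih (by omega) hu
      have hadj := hH huv
      obtain ⟨Z', hZ', hsub⟩ := exists_refineCut_of_mem (own := ident v) (i := i)
        (X := X.cut v p i) (T := X.heard v p i) (Y := insert s(name M ident v, name M ident u) Z)
        (Or.inr ⟨ident u, Z, (X.mem_heard_none_iff hC hG hinj hq hadj (by omega)).2 ⟨Z, hZ⟩,
          fun f => (X.mem_heard_some_iff hC hG hinj hq hadj (by omega) hZ f).symm,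
          C.card_cutAt_le hZ, rfl⟩)
      refine ⟨Z', hZ', fun h => ?_⟩
      rcases Finset.mem_insert.1 (hsub h) with h | h
      · exact hx v u huv.symm h.symm
      · exact hxZ h

/-- Whoever accepts is joined to a source by a short walk avoiding the adversarial edge. -/
lemma mem_reach_of_accept (hC : C.Valid) (hG : (G.deleteEdges {e}).Connected)
    (hinj : Function.Injective ident) {p : ℕ} (hq : X.Quiet p) {v : V}
    (h : X.cut v p (C.len p) = some ∅) :
    v ∈ reach (G.deleteEdges {e}) (X.sources p) (C.len p) :=
  X.mem_reach_of_notMem_cut hC hG hinj hq le_rfl h (Finset.notMem_empty _)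

lemma not_accept_of_sources_eq_empty (hC : C.Valid) (hG : (G.deleteEdges {e}).Connected)
    (hinj : Function.Injective ident) {p : ℕ} (hq : X.Quiet p) (hs : X.sources p = ∅) (v : V) :
    X.cut v p (C.len p) ≠ some ∅ := by
  intro h
  obtain ⟨u, hu, -⟩ := exists_mem_of_mem_reach (X.mem_reach_of_accept hC hG hinj hq h)
  simp [hs] at hu

/-- A vertex accepts if no further edge cuts it off from the sources. -/
lemma accept_of_forall_reach (hC : C.Valid) (hG : (G.deleteEdges {e}).Connected)
    (hinj : Function.Injective ident) (hM : ∀ v, ident v < M) {p : ℕ} (hq : X.Quiet p) {v : V}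
    (h : ∀ f, v ∈ reach (G.deleteEdges {f, e}) (X.sources p) (C.len p)) :
    X.cut v p (C.len p) = some ∅ := by
  have hle : ∀ f, G.deleteEdges {f, e} ≤ G.deleteEdges {e} := fun f =>
    G.deleteEdges_anti (by simp)
  have key : ∀ x : Sym2 (Fin M), ∃ Z, X.cut v p (C.len p) = some Z ∧ x ∉ Z := by
    intro x
    by_cases hx : ∃ f : Sym2 V, f.map (name M ident) = x
    · obtain ⟨f, rfl⟩ := hx
      refine X.exists_cut_notMem hC hG hinj hq (hle f) (fun u w huw hf => ?_) le_rfl (h f)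
      rw [← Sym2.map_mk] at hf
      have := Sym2.map.injective (name_injective hinj hM) hf
      rw [SimpleGraph.deleteEdges_adj] at huw
      exact huw.2 (by simp [this])
    -- A name borne by no pair of vertices is avoided by every walk, so `f = e` will do.
    · refine X.exists_cut_notMem hC hG hinj hq (hle e) (fun u w _ hf => hx ⟨s(u, w), ?_⟩) le_rfl (h e)
      rw [Sym2.map_mk, hf]
  obtain ⟨Z, hZ, -⟩ := key (e.map (name M ident))
  rw [hZ, Option.some_inj, Finset.eq_empty_iff_forall_notMem]
  intro x hx
  obtain ⟨Z', hZ', hx'⟩ := key x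
  obtain rfl := Option.some.inj (hZ.symm.trans hZ')
  exact hx' hx

end Execution

/-! ### Messages as sets of facts. -/

section Encoding

/-- The facts that describe a message: fact `0` holds always, fact `2 * r + 1` says that there is
a bit number `r`, and fact `2 * r + 2` that this bit is `1`. -/
def Fact (m : List Bool) (c : ℕ) : Prop :=
  c = 0 ∨ (∃ r, c = 2 * r + 1 ∧ r < m.length) ∨ ∃ r, c = 2 * r + 2 ∧ m[r]? = some true

lemma fact_zero (m : List Bool) : Fact m 0 := Or.inl rfl

lemma fact_odd {m : List Bool} {r : ℕ} : Fact m (2 * r + 1) ↔ r < m.length := by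
  constructor
  · rintro (h | ⟨r', h, h'⟩ | ⟨r', h, -⟩)
    · omega
    · rwa [show r = r' by omega]
    · omega
  · exact fun h => Or.inr (Or.inl ⟨r, rfl, h⟩)

lemma fact_even {m : List Bool} {r : ℕ} : Fact m (2 * r + 2) ↔ m[r]? = some true := by
  constructor
  · rintro (h | ⟨r', h, -⟩ | ⟨r', h, h'⟩)
    · omega
    · omega
    · rwa [show r = r' by omega]
  · exact fun h => Or.inr (Or.inr ⟨r, rfl, h⟩)

/-- Odd facts determine the length and even ones the bits, so the choice made in the decision rule
is unambiguous. -/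
lemma eq_of_fact_iff {L : ℕ} {m m' : List Bool} (hm : m.length ≤ L) (hm' : m'.length ≤ L)
    (h : ∀ c < 2 * L + 1, (Fact m c ↔ Fact m' c)) : m = m' := by
  have h1 : ∀ r < L, (r < m.length ↔ r < m'.length) := fun r hr => by
    simpa only [fact_odd] using h (2 * r + 1) (by omega)
  have hl : m.length = m'.length := by
    rcases lt_trichotomy m.length m'.length with hlt | heq | hlt
    · have := h1 m.length (by omega)
      omega
    · exact heq
    · have := h1 m'.length (by omega)
      omega
  refine List.ext_getElem hl fun r hr hr' => ?_
  have h2 := h (2 * r + 2) (by omega)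
  rw [fact_even, fact_even, List.getElem?_eq_getElem hr, List.getElem?_eq_getElem hr',
    Option.some_inj, Option.some_inj] at h2
  exact Bool.eq_iff_iff.2 h2

end Encoding

/-! ### The broadcast scheme and its timing. -/

section Broadcast

/-- The number of channels of a phase. -/
def phaseLen (L : ℕ) : ℕ := 2 * L + 3

open Classical in
/-- The broadcast scheme for messages of length at most `L`. In the first channel of phase `j` the
source floods to distance about `2 ^ j`. In the second one those who have not accepted raise an
alarm. Unless the source hears the alarm, it broadcasts the facts about its message. -/
noncomputable def broadcast {M b : ℕ} (enc : Option (Sym2 (Fin M)) → Msg b) (L : ℕ) :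
    Scheme M b where
  enc := enc
  len p := if p % phaseLen L = 0 then 2 ^ (p / phaseLen L) else 104 * 2 ^ (p / phaseLen L)
  src inp p acc := (p % phaseLen L = 0 ∧ inp.source ≠ none) ∨
    (p % phaseLen L = 1 ∧ p / phaseLen L * phaseLen L ∉ acc) ∨
    ∃ c m, p % phaseLen L = c + 2 ∧ inp.source = some m ∧
      p / phaseLen L * phaseLen L + 1 ∉ acc ∧ Fact m c
  res p acc := if h : ∃ o : List Bool × ℕ, ∃ j, p = (j + 1) * phaseLen L ∧ o.1.length ≤ L ∧
      o.2 = 8 * 2 ^ j ∧ ∀ c < 2 * L + 1, (j * phaseLen L + (c + 2) ∈ acc ↔ Fact o.1 c)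
    then some h.choose else none

lemma phase_mod {L j r : ℕ} (hr : r < phaseLen L) : (j * phaseLen L + r) % phaseLen L = r := by
  rw [Nat.mul_add_mod_self_right, Nat.mod_eq_of_lt hr]

lemma phase_div {L j r : ℕ} (hr : r < phaseLen L) : (j * phaseLen L + r) / phaseLen L = j := by
  rw [Nat.add_comm, Nat.add_mul_div_right _ _ (by omega), Nat.div_eq_of_lt hr, Nat.zero_add]

variable {M b : ℕ} {enc : Option (Sym2 (Fin M)) → Msg b} {L : ℕ}

lemma broadcast_len_zero (j : ℕ) : (broadcast enc L).len (j * phaseLen L) = 2 ^ j := by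
  have h0 : 0 < phaseLen L := by simp [phaseLen]
  have h1 := phase_mod (j := j) h0
  have h2 := phase_div (j := j) h0
  rw [Nat.add_zero] at h1 h2
  simp [broadcast, h2]

lemma broadcast_len_of_pos {j r : ℕ} (hr : r < phaseLen L) (h : 0 < r) :
    (broadcast enc L).len (j * phaseLen L + r) = 104 * 2 ^ j := by
  simp only [broadcast, phase_mod hr, phase_div hr, h.ne', if_false]

lemma broadcast_src {inp : LocalInput} {p : ℕ} {acc : Set ℕ} : (broadcast enc L).src inp p acc ↔
    (p % phaseLen L = 0 ∧ inp.source ≠ none) ∨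
    (p % phaseLen L = 1 ∧ p / phaseLen L * phaseLen L ∉ acc) ∨
    ∃ c m, p % phaseLen L = c + 2 ∧ inp.source = some m ∧
      p / phaseLen L * phaseLen L + 1 ∉ acc ∧ Fact m c := Iff.rfl

lemma broadcast_valid (hinj : Function.Injective enc) (hping : ∀ x, enc x ≠ ping b) :
    (broadcast enc L).Valid where
  res_zero A := by
    refine dif_neg ?_
    rintro ⟨o, j, h, -⟩
    have : 0 < (j + 1) * phaseLen L := by simp [phaseLen]
    omega
  len_pos p := by
    simp only [broadcast]
    split_ifs <;> positivity
  enc_inj := hinj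
  enc_ne_ping := hping

lemma broadcast_startTime_add_le (j : ℕ) {r : ℕ} (hr : r ≤ phaseLen L) :
    (broadcast enc L).startTime (j * phaseLen L + r) ≤
      (broadcast enc L).startTime (j * phaseLen L) + r * (11128 * 4 ^ j) := by
  induction r with
  | zero => simp
  | succ r ih =>
    have hlen : (broadcast enc L).len (j * phaseLen L + r) ≤ 104 * 2 ^ j := by
      simp only [broadcast, phase_mod (show r < phaseLen L by omega),
        phase_div (show r < phaseLen L by omega)]
      split_ifs <;> omega
    have h4 : 4 ^ j = 2 ^ j * 2 ^ j := by rw [← mul_pow]; norm_num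
    have h1 : 1 ≤ 2 ^ j := Nat.one_le_two_pow
    rw [← Nat.add_assoc, Scheme.startTime, Scheme.width]
    -- Here `11128 = 104 * 107`, from `3 ≤ 3 * 2 ^ j`.
    have : (broadcast enc L).len (j * phaseLen L + r) *
        ((broadcast enc L).len (j * phaseLen L + r) + 3) ≤ 11128 * 4 ^ j := by
      calc _ ≤ (104 * 2 ^ j) * (104 * 2 ^ j + 3 * 2 ^ j) := by gcongr; omega
        _ = 11128 * 4 ^ j := by rw [h4]; ring
    have := ih (by omega)
    rw [Nat.succ_mul]
    omega

lemma broadcast_startTime_le (j : ℕ) :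
    (broadcast enc L).startTime (j * phaseLen L) ≤ phaseLen L * (11128 * 4 ^ j) := by
  induction j with
  | zero => simp [Scheme.startTime]
  | succ j ih =>
    rw [Nat.succ_mul]
    -- The geometric sum: the earlier phases and phase `j` each cost at most the `4 ^ j` term, and
    -- `2 * 4 ^ j ≤ 4 ^ (j + 1)`.
    refine (broadcast_startTime_add_le j le_rfl).trans ?_
    rw [pow_succ]
    nlinarith [Nat.zero_le (phaseLen L * (11128 * 4 ^ j))]

lemma broadcast_res_of_mod_ne {p : ℕ} (hp : p % phaseLen L ≠ 0) (acc : Set ℕ) :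
    (broadcast enc L).res p acc = none := by
  refine dif_neg ?_
  rintro ⟨o, j, rfl, -⟩
  simp at hp

/-- Fact `0` holds for every message, so no decision is made without it. -/
lemma broadcast_res_eq_none {j : ℕ} {acc : Set ℕ} (h : j * phaseLen L + 2 ∉ acc) :
    (broadcast enc L).res ((j + 1) * phaseLen L) acc = none := by
  refine dif_neg ?_
  rintro ⟨o, j', hj, -, -, hc⟩
  have : j + 1 = j' + 1 := Nat.eq_of_mul_eq_mul_right (by simp [phaseLen]) hj
  obtain rfl : j = j' := by omega
  exact h ((hc 0 (by omega)).2 (fact_zero _))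

lemma broadcast_res_eq_some {j : ℕ} {acc : Set ℕ} {m : List Bool} (hm : m.length ≤ L)
    (h : ∀ c < 2 * L + 1, (j * phaseLen L + (c + 2) ∈ acc ↔ Fact m c)) :
    (broadcast enc L).res ((j + 1) * phaseLen L) acc = some (m, 8 * 2 ^ j) := by
  have hex : ∃ o : List Bool × ℕ, ∃ j', (j + 1) * phaseLen L = (j' + 1) * phaseLen L ∧
      o.1.length ≤ L ∧ o.2 = 8 * 2 ^ j' ∧
        ∀ c < 2 * L + 1, (j' * phaseLen L + (c + 2) ∈ acc ↔ Fact o.1 c) :=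
    ⟨(m, 8 * 2 ^ j), j, rfl, hm, rfl, h⟩
  refine (dif_pos hex).trans ?_
  obtain ⟨j', hj, h1, h2, h3⟩ := hex.choose_spec
  have : j + 1 = j' + 1 := Nat.eq_of_mul_eq_mul_right (by simp [phaseLen]) hj
  obtain rfl : j = j' := by omega
  rw [Option.some_inj]
  exact Prod.ext (eq_of_fact_iff h1 hm fun c hc => (h3 c hc).symm.trans (h c hc)) h2

end Broadcast

/-! ### Correctness of the phases. -/

namespace Execution

variable {V : Type*} [Fintype V] {M b : ℕ} [NeZero M] {enc : Option (Sym2 (Fin M)) → Msg b}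
  {L : ℕ} {G : SimpleGraph V} {ident : V → ℕ} {s : V} {m₀ : List Bool} {e : Sym2 V}
  (X : Execution (broadcast enc L) G ident s m₀ e)

/-- Decisions are made only between phases. -/
lemma Quiet.add {j : ℕ} (hq : X.Quiet (j * phaseLen L)) {r : ℕ} (hr : r < phaseLen L) :
    X.Quiet (j * phaseLen L + r) := by
  intro v p' hp'
  rcases le_or_gt p' (j * phaseLen L) with h | h
  · exact hq v p' h
  · obtain ⟨r', rfl⟩ := Nat.exists_eq_add_of_le h.le
    apply broadcast_res_of_mod_ne
    rw [phase_mod (by omega)]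
    omega

lemma sources_flood (j : ℕ) : X.sources (j * phaseLen L) = {s} := by
  ext v
  simp only [sources, broadcast_src, Set.mem_ofPred_eq, Nat.mul_mod_left, localInput]
  by_cases hv : v = s <;> simp [hv]

lemma mem_sources_alarm (hC : (broadcast enc L).Valid) (j : ℕ) (v : V) :
    v ∈ X.sources (j * phaseLen L + 1) ↔
      X.cut v (j * phaseLen L) ((broadcast enc L).len (j * phaseLen L)) ≠ some ∅ := by
  have h1 : 1 < phaseLen L := by simp [phaseLen]
  have := X.mem_acc_iff hC.len_pos (v := v) (p := j * phaseLen L + 1) (r := j * phaseLen L)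
  simp only [sources, Set.mem_ofPred_eq, broadcast_src]
  rw [phase_mod h1, phase_div h1]
  simp [this]

/-- The source hears no alarm in phase `j`. -/
def Passes (j : ℕ) : Prop :=
  X.cut s (j * phaseLen L + 1) ((broadcast enc L).len (j * phaseLen L + 1)) ≠ some ∅

lemma mem_sources_fact (hC : (broadcast enc L).Valid) (j : ℕ) {c : ℕ} (hc : c < 2 * L + 1)
    (v : V) : v ∈ X.sources (j * phaseLen L + (c + 2)) ↔ v = s ∧ X.Passes j ∧ Fact m₀ c := by
  have h1 : c + 2 < phaseLen L := by simp only [phaseLen]; omega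
  have := X.mem_acc_iff hC.len_pos (v := s) (p := j * phaseLen L + (c + 2))
    (r := j * phaseLen L + 1)
  simp only [sources, Set.mem_ofPred_eq, broadcast_src]
  rw [phase_mod h1, phase_div h1]
  by_cases hv : v = s
  · subst hv
    simp [this, localInput, Passes]
  · simp [hv, localInput]

variable [Nontrivial V]

lemma passes_of_diam_le (hG : G.IsEdgeConnected 3) (hC : (broadcast enc L).Valid)
    (hinj : Function.Injective ident) (hM : ∀ v, ident v < M) {j : ℕ}
    (hq : X.Quiet (j * phaseLen L)) (hj : 13 * G.diam ≤ 2 ^ j) : X.Passes j := by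
  have hc1 : (G.deleteEdges {e}).Connected := by simpa using connected_deleteEdges_pair hG e e
  refine X.not_accept_of_sources_eq_empty hC hc1 hinj
    (Quiet.add X hq (by simp [phaseLen])) ?_ s
  rw [Set.eq_empty_iff_forall_notMem]
  intro v
  rw [X.mem_sources_alarm hC, not_not]
  refine X.accept_of_forall_reach hC hc1 hinj hM hq fun f => ?_
  rw [X.sources_flood, broadcast_len_zero]
  exact mem_reach_of_dist_le (connected_deleteEdges_pair hG f e) rfl
    ((dist_deleteEdges_pair_le hG f e s v).trans hj)

lemma diam_le_of_passes (hG : G.IsEdgeConnected 3) (hC : (broadcast enc L).Valid)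
    (hinj : Function.Injective ident) (hM : ∀ v, ident v < M) {j : ℕ}
    (hq : X.Quiet (j * phaseLen L)) (hj : X.Passes j) : G.diam ≤ 8 * 2 ^ j := by
  have hc1 : (G.deleteEdges {e}).Connected := by simpa using connected_deleteEdges_pair hG e e
  have h1 : 1 ≤ 2 ^ j := Nat.one_le_two_pow
  by_contra! hlt
  refine hj (X.accept_of_forall_reach hC hc1 hinj hM
    (Quiet.add X hq (by simp [phaseLen])) fun f => ?_)
  rw [broadcast_len_of_pos (by simp only [phaseLen]; omega) one_pos]
  by_contra hs
  -- By `hs`, no alarm source is within `104 * 2 ^ j` of `s` in `G - f - e`, so all vertices there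
  -- accepted the flood.
  have hnear : ∀ x, (G.deleteEdges {f, e}).dist s x ≤ 3 * 2 ^ j + 2 →
      x ∈ reach (G.deleteEdges {e}) {s} (2 ^ j) := by
    intro x hx
    have hx' : x ∉ X.sources (j * phaseLen L + 1) := fun hmem => hs <|
      mem_reach_of_dist_le (connected_deleteEdges_pair hG f e) hmem <| by
        rw [SimpleGraph.dist_comm]
        omega
    rw [X.mem_sources_alarm hC, not_not] at hx'
    have := X.mem_reach_of_accept hC hc1 hinj hq hx'
    rwa [X.sources_flood, broadcast_len_zero] at this
  -- The diameter is at most `2 * (3 * 2 ^ j + 1) ≤ 8 * 2 ^ j`.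
  have := diam_le_two_mul (hG.connected (by norm_num))
    (dist_le_of_reach_deleteEdges hG f e hnear)
  omega

/-- After an accepted alarm the fact channels have no source, so nobody can accept fact `0`. -/
lemma quiet_of_not_passes (hG : G.IsEdgeConnected 3) (hC : (broadcast enc L).Valid)
    (hinj : Function.Injective ident) {j : ℕ}
    (hq : X.Quiet (j * phaseLen L)) (hj : ¬X.Passes j) : X.Quiet ((j + 1) * phaseLen L) := by
  have hc1 : (G.deleteEdges {e}).Connected := by simpa using connected_deleteEdges_pair hG e e
  have hlast : phaseLen L - 1 < phaseLen L := by simp [phaseLen]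
  intro v p' hp'
  rcases Nat.lt_or_ge p' ((j + 1) * phaseLen L) with h | h
  · exact Quiet.add X hq hlast v p' (by rw [Nat.succ_mul] at h; omega)
  · obtain rfl : p' = (j + 1) * phaseLen L := le_antisymm hp' h
    refine broadcast_res_eq_none fun hmem => ?_
    rw [X.mem_acc_iff hC.len_pos] at hmem
    refine X.not_accept_of_sources_eq_empty hC hc1 hinj
      (Quiet.add X hq (r := 0 + 2) (by simp [phaseLen])) ?_ v hmem.2
    rw [Set.eq_empty_iff_forall_notMem]
    intro u hu
    exact hj ((X.mem_sources_fact hC j (by omega) u).1 hu).2.1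

lemma res_of_passes (hG : G.IsEdgeConnected 3) (hC : (broadcast enc L).Valid)
    (hinj : Function.Injective ident) (hM : ∀ v, ident v < M) (hm : m₀.length ≤ L) {j : ℕ}
    (hq : X.Quiet (j * phaseLen L)) (hj : X.Passes j) (v : V) :
    (broadcast enc L).res ((j + 1) * phaseLen L) (X.acc v ((j + 1) * phaseLen L)) =
      some (m₀, 8 * 2 ^ j) := by
  have hc1 : (G.deleteEdges {e}).Connected := by simpa using connected_deleteEdges_pair hG e e
  have hdiam := X.diam_le_of_passes hG hC hinj hM hq hj
  refine broadcast_res_eq_some hm fun c hc => ?_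
  have hlt : c + 2 < phaseLen L := by simp only [phaseLen]; omega
  rw [X.mem_acc_iff hC.len_pos, Nat.succ_mul, and_iff_right (by omega)]
  have hq' := Quiet.add X hq hlt
  constructor
  · intro h
    by_contra hfact
    refine X.not_accept_of_sources_eq_empty hC hc1 hinj hq' ?_ v h
    rw [Set.eq_empty_iff_forall_notMem]
    intro u hu
    exact hfact ((X.mem_sources_fact hC j hc u).1 hu).2.2
  · intro hfact
    refine X.accept_of_forall_reach hC hc1 hinj hM hq' fun f => ?_
    refine mem_reach_of_dist_le (connected_deleteEdges_pair hG f e)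
      ((X.mem_sources_fact hC j hc s).2 ⟨rfl, hj, hfact⟩) ?_
    -- The length `104 * 2 ^ j = 13 * (8 * 2 ^ j)` is at least `13 * D`.
    rw [broadcast_len_of_pos hlt (by omega)]
    exact (dist_deleteEdges_pair_le hG f e s v).trans (by omega)

/-- The source passes in a phase of order the diameter. -/
lemma exists_passes (hG : G.IsEdgeConnected 3) (hC : (broadcast enc L).Valid)
    (hinj : Function.Injective ident) (hM : ∀ v, ident v < M) :
    ∃ j, X.Quiet (j * phaseLen L) ∧ X.Passes j ∧ 2 ^ j ≤ 26 * G.diam := by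
  have hD : G.diam ≠ 0 := SimpleGraph.connected_iff_diam_ne_zero.1 (hG.connected (by norm_num))
  have key : ∀ j, X.Quiet (j * phaseLen L) ∨ ∃ i < j, X.Quiet (i * phaseLen L) ∧ X.Passes i := by
    intro j
    induction j with
    | zero =>
      left
      intro v p hp
      rw [Nat.zero_mul, Nat.le_zero] at hp
      rw [hp]
      exact hC.res_zero _
    | succ j ih =>
      rcases ih with h | ⟨i, hi, h⟩
      · by_cases hp : X.Passes j
        · exact Or.inr ⟨j, by omega, h, hp⟩
        · exact Or.inl (X.quiet_of_not_passes hG hC hinj h hp)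
      · exact Or.inr ⟨i, by omega, h⟩
  have hle : 13 * G.diam ≤ 2 ^ Nat.clog 2 (13 * G.diam) := Nat.le_pow_clog (by norm_num) _
  have hlt : 2 ^ Nat.clog 2 (13 * G.diam) ≤ 26 * G.diam := by
    have := Nat.pow_pred_clog_lt_self (b := 2) (by norm_num) (x := 13 * G.diam) (by omega)
    have h2 := Nat.clog_pos (b := 2) (by norm_num) (n := 13 * G.diam) (by omega)
    obtain ⟨i, hi⟩ : ∃ i, Nat.clog 2 (13 * G.diam) = i + 1 := ⟨_, (Nat.succ_pred h2.ne').symm⟩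
    rw [hi, Nat.pred_succ] at this
    rw [hi, pow_succ]
    omega
  rcases key (Nat.clog 2 (13 * G.diam)) with h | ⟨i, hi, h1, h2⟩
  · exact ⟨_, h, X.passes_of_diam_le hG hC hinj hM h hle, hlt⟩
  · exact ⟨i, h1, h2, (Nat.pow_le_pow_right (by norm_num) hi.le).trans hlt⟩

/-- All nodes halt with the message and an estimate of the diameter. -/
theorem exists_halted (hG : G.IsEdgeConnected 3) (hC : (broadcast enc L).Valid)
    (hinj : Function.Injective ident) (hM : ∀ v, ident v < M) (hm : m₀.length ≤ L) (v : V) {t : ℕ}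
    (ht : (13 + phaseLen L * 30090112) * G.diam ^ 2 ≤ t) :
    ∃ d q, X.cfg t v = some q ∧ (broadcast enc L).protocol.output q = some (m₀, d) ∧
      G.diam ≤ d ∧ d ≤ 208 * G.diam := by
  have hc1 : (G.deleteEdges {e}).Connected := by simpa using connected_deleteEdges_pair hG e e
  have hD : G.diam ≠ 0 := SimpleGraph.connected_iff_diam_ne_zero.1 (hG.connected (by norm_num))
  obtain ⟨j, hq, hp, hj⟩ := X.exists_passes hG hC hinj hM
  have hres := X.res_of_passes hG hC hinj hM hm hq hp v
  have hlast : phaseLen L - 1 < phaseLen L := by simp [phaseLen]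
  have heq : (j + 1) * phaseLen L = j * phaseLen L + (phaseLen L - 1) + 1 := by
    rw [Nat.succ_mul]
    omega
  have hwake : X.wake v ≤ 13 * G.diam := by
    refine X.wake_le_of_reach hC.res_zero hC.len_pos (mem_reach_of_dist_le hc1 rfl ?_)
    simpa using dist_deleteEdges_pair_le hG e e s v
  have htime : X.wake v + (broadcast enc L).startTime ((j + 1) * phaseLen L) ≤ t := by
    refine le_trans ?_ ht
    have h4 : 4 ^ (j + 1) = 4 * (2 ^ j) ^ 2 := by
      rw [pow_succ, ← pow_mul, Nat.mul_comm j, pow_mul]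
      ring
    -- The constant is `30090112 = 11128 * 4 * 26 ^ 2`.
    calc _ ≤ 13 * G.diam + phaseLen L * (11128 * 4 ^ (j + 1)) :=
          Nat.add_le_add hwake (broadcast_startTime_le _)
      _ ≤ 13 * G.diam ^ 2 + phaseLen L * (11128 * (4 * (26 * G.diam) ^ 2)) := by
          rw [h4]
          gcongr
          exact Nat.le_self_pow (by norm_num) _
      _ = _ := by ring
  rw [heq] at hres htime
  obtain ⟨q, h1, h2⟩ := X.exists_cfg_of_res hC.res_zero hC.len_pos hc1
    (Quiet.add X hq hlast v) hres htime
  exact ⟨_, q, h1, h2, X.diam_le_of_passes hG hC hinj hM hq hp, by omega⟩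

end Execution

/-! ### Encoding of edge names and final constants. -/

/-- Edge names are encoded by bit strings of full length. -/
lemma exists_enc {M b : ℕ} (hb : 0 < b) (hM : M ^ 2 + 1 ≤ 2 ^ b) :
    ∃ enc : Option (Sym2 (Fin M)) → Msg b, Function.Injective enc ∧ ∀ x, enc x ≠ ping b := by
  have hcard : Fintype.card (Option (Sym2 (Fin M))) ≤ Fintype.card (List.Vector Bool b) := by
    rw [Fintype.card_option, card_vector, Fintype.card_bool]
    refine le_trans ?_ hM
    have := Fintype.card_le_of_surjective (fun x : Fin M × Fin M => s(x.1, x.2))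
      (fun z => z.inductionOn fun x y => ⟨(x, y), rfl⟩)
    rw [Fintype.card_prod, Fintype.card_fin] at this
    nlinarith
  obtain ⟨f⟩ := Function.Embedding.nonempty_of_card_le hcard
  refine ⟨fun x => ⟨(f x).1, (f x).2.le⟩, fun x y h => ?_, fun x h => ?_⟩
  · exact f.injective (Subtype.ext (congrArg (fun w : Msg b => w.1) h))
  · have h1 : (f x).1 = [] := congrArg Subtype.val h
    have h2 := (f x).2
    rw [h1] at h2
    simp at h2
    omega

/-- An encoding of edge names. -/
noncomputable def edgeCode (M b : ℕ) : Option (Sym2 (Fin M)) → Msg b :=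
  -- The algorithm must be defined for every `N`, even where no suitable encoding exists.
  @Classical.epsilon _ ⟨fun _ => ping b⟩ fun enc => Function.Injective enc ∧ ∀ x, enc x ≠ ping b

lemma edgeCode_spec {M b : ℕ} (hb : 0 < b) (hM : M ^ 2 + 1 ≤ 2 ^ b) :
    Function.Injective (edgeCode M b) ∧ ∀ x, edgeCode M b x ≠ ping b :=
  Classical.epsilon_spec (exists_enc hb hM)

/-- The algorithm run with the estimate `N` of the number of nodes. -/
noncomputable def broadcastAlg (k N : ℕ) : Protocol ((2 * k + 3) * Nat.clog 2 N) :=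
  (broadcast (edgeCode (N ^ k + 1) ((2 * k + 3) * Nat.clog 2 N)) (k * Nat.clog 2 N)).protocol

lemma sq_add_one_le_two_pow {N : ℕ} (hN : 2 ≤ N) (k : ℕ) :
    (N ^ k + 1) ^ 2 + 1 ≤ 2 ^ ((2 * k + 3) * Nat.clog 2 N) := by
  have hc : 0 < Nat.clog 2 N := Nat.clog_pos (by norm_num) hN
  have h1 : N ^ k ≤ 2 ^ (k * Nat.clog 2 N) := by
    rw [Nat.mul_comm, pow_mul]
    exact Nat.pow_le_pow_left (Nat.le_pow_clog (by norm_num) N) k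
  have h2 : 1 ≤ 2 ^ (k * Nat.clog 2 N) := Nat.one_le_two_pow
  calc (N ^ k + 1) ^ 2 + 1 ≤ 2 ^ 3 * (2 ^ (k * Nat.clog 2 N)) ^ 2 := by
        generalize N ^ k = x at *
        generalize 2 ^ (k * Nat.clog 2 N) = y at *
        nlinarith
    _ = 2 ^ (3 + 2 * (k * Nat.clog 2 N)) := by rw [pow_add, ← pow_mul, Nat.mul_comm 2 (k * _)]
    _ ≤ _ := Nat.pow_le_pow_right (by norm_num) (by nlinarith)

/-- The execution given by `run`. -/
noncomputable def runExecution {V : Type*} [Fintype V] {M b : ℕ} [NeZero M] (C : Scheme M b)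
    (G : SimpleGraph V) (ident : V → ℕ) (s : V) (m₀ : List Bool) (F : Set (Sym2 V))
    (A : Adversary V b) {e : Sym2 V} (hF : F ⊆ {e}) : Execution C G ident s m₀ e where
  cfg t := (run G ident C.protocol s m₀ F A t).1
  traffic t := delivered F (sent C.protocol ident (run G ident C.protocol s m₀ F A t).1)
    (A (sent C.protocol ident (run G ident C.protocol s m₀ F A t).1 ::
      (run G ident C.protocol s m₀ F A t).2))
  cfg_zero_source := if_pos rfl
  cfg_zero_of_ne _ hv := if_neg hv
  cfg_succ _ _ := rfl
  faithful _ _ _ h := if_neg fun hmem => h (hF hmem)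

lemma exists_subset_singleton {α : Type*} [Nonempty α] {F : Set α} (hF : F.encard ≤ 1) :
    ∃ e, F ⊆ {e} := by
  rcases F.eq_empty_or_nonempty with rfl | ⟨e, he⟩
  · exact ⟨Classical.arbitrary α, Set.empty_subset _⟩
  · exact ⟨e, fun f hf => Set.encard_le_one_iff.1 hF f e hf he⟩

lemma time_bound (k n N D : ℕ) (hn : 2 ≤ n) (hN : N ≤ n ^ k) :
    (13 + phaseLen (k * Nat.clog 2 N) * 30090112) * D ^ 2 ≤
      (13 + (2 * k ^ 2 + 3) * 30090112) * D ^ 2 *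
        Nat.clog 2 n ^ (13 + (2 * k ^ 2 + 3) * 30090112) := by
  have hc : 1 ≤ Nat.clog 2 n := Nat.clog_pos (by norm_num) hn
  have hcN : Nat.clog 2 N ≤ k * Nat.clog 2 n := by
    refine Nat.clog_le_of_le_pow (hN.trans ?_)
    rw [Nat.mul_comm, pow_mul]
    exact Nat.pow_le_pow_left (Nat.le_pow_clog (by norm_num) n) k
  have hP : phaseLen (k * Nat.clog 2 N) ≤ (2 * k ^ 2 + 3) * Nat.clog 2 n := by
    have := Nat.mul_le_mul_left k hcN
    unfold phaseLen
    nlinarith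
  generalize 30090112 = T at *
  -- One factor `log n` suffices; the large exponent appears because the theorem uses one constant
  -- as factor and exponent.
  have hpow : Nat.clog 2 n ≤ Nat.clog 2 n ^ (13 + (2 * k ^ 2 + 3) * T) :=
    Nat.le_self_pow (by omega) _
  calc (13 + phaseLen (k * Nat.clog 2 N) * T) * D ^ 2
      ≤ (13 * Nat.clog 2 n + (2 * k ^ 2 + 3) * Nat.clog 2 n * T) * D ^ 2 := by
        gcongr
        omega
    _ = (13 + (2 * k ^ 2 + 3) * T) * D ^ 2 * Nat.clog 2 n := by ring
    _ ≤ _ := by gcongr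

theorem broadcastAlg_haltedWith {V : Type*} [Fintype V] [Nontrivial V] {G : SimpleGraph V}
    (hG : G.IsEdgeConnected 3) {ident : V → ℕ} (hinj : Function.Injective ident) {k N : ℕ}
    (hident : ∀ v, ident v ≤ N ^ k) (hN : 2 ≤ N) (s : V) {m₀ : List Bool}
    (hm : m₀.length ≤ k * Nat.clog 2 N) {F : Set (Sym2 V)} (hF : F.encard ≤ 1)
    (A : Adversary V ((2 * k + 3) * Nat.clog 2 N)) (v : V) {t : ℕ}
    (ht : (13 + phaseLen (k * Nat.clog 2 N) * 30090112) * G.diam ^ 2 ≤ t) :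
    ∃ d, HaltedWith G ident (broadcastAlg k N) s m₀ F A t v m₀ d ∧
      G.diam ≤ d ∧ d ≤ 208 * G.diam := by
  have hb : 0 < (2 * k + 3) * Nat.clog 2 N :=
    Nat.mul_pos (by omega) (Nat.clog_pos (by norm_num) hN)
  have : Nonempty (Sym2 V) := ⟨s(s, s)⟩
  obtain ⟨e, he⟩ := exists_subset_singleton hF
  have henc := edgeCode_spec hb (sq_add_one_le_two_pow hN k)
  obtain ⟨d, q, h1, h2, h3, h4⟩ := (runExecution _ G ident s m₀ F A he).exists_halted hG
    (broadcast_valid henc.1 henc.2) hinj (fun u => Nat.lt_succ_of_le (hident u)) hm v ht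
  exact ⟨d, ⟨q, h1, h2⟩, h3, h4⟩

end AdvCongest

open AdvCongest in
theorem theorem1 :
    -- `a`: the approximation factor of the diameter estimate, an absolute constant
    ∃ a : ℕ,
    -- `k`: the constant in the polynomial bounds on the identifiers and on the estimate of the
    -- number of nodes, and in the length `O(log n)` of the message
    ∀ k : ℕ,
    -- `B`, `C`: the constants in the bandwidth `O(log n)` and in the round complexity;
    -- `alg N`: the algorithm run by nodes that know the estimate `N` of the number of nodes
    ∃ (B C : ℕ) (alg : (N : ℕ) → Protocol (B * Nat.clog 2 N)),
    ∀ (V : Type) [Fintype V] [Nontrivial V] (G : SimpleGraph V), G.IsEdgeConnected 3 →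
    ∀ ident : V → ℕ, Function.Injective ident → (∀ v, ident v ≤ Fintype.card V ^ k) →
    ∀ N : ℕ, Fintype.card V ≤ N → N ≤ Fintype.card V ^ k →
    ∀ (s : V) (m₀ : List Bool), m₀.length ≤ k * Nat.clog 2 (Fintype.card V) →
    ∀ F : Set (Sym2 V), F ⊆ G.edgeSet → F.encard ≤ 1 →
    ∀ A : Adversary V (B * Nat.clog 2 N),
    ∀ v : V, ∃ d : ℕ,
      HaltedWith G ident (alg N) s m₀ F A
        (C * G.diam ^ 2 * Nat.clog 2 (Fintype.card V) ^ C) v m₀ d ∧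
      G.diam ≤ d ∧ d ≤ a * G.diam := by
  refine ⟨208, fun k => ⟨2 * k + 3, 13 + (2 * k ^ 2 + 3) * 30090112, broadcastAlg k, ?_⟩⟩
  intro V _ _ G hG ident hinj hident N hnN hNn s m₀ hm F _ hF A v
  have hn : 2 ≤ Fintype.card V := Fintype.one_lt_card
  exact broadcastAlg_haltedWith hG hinj
    (fun u => (hident u).trans (Nat.pow_le_pow_left hnN k)) (hn.trans hnN) s
    (hm.trans (Nat.mul_le_mul_left k (Nat.clog_mono_right 2 hnN))) hF A v
    (time_bound k _ N G.diam hn hNn)
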